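/- **Setting.** Write $\langle x\rangle=(1+|x|^2)^{1/2}$ and let $\mathcal E[\mathbb R^d]$ be the set of nets $(u_\epsilon)_{\epsilon\in(0,1]}$ of smooth functions $u_\epsilon:\mathbb R^d\to\mathbb C$. Let * $\mathcal E_\tau(\mathbb R^d)$ be the nets in $\mathcal E[\mathbb R^d]$ such that for all $\alpha\in\mathbb N^d$ there is $N\in\mathbb N$ with $\sup_{\epsilon\in(0,1]}\epsilon^N\|\langle x\rangle^{-N}\partial^\alpha u_\epsilon\|_{L^\infty}<\infty$; * $\mathcal N_{\mathcal S}(\mathbb R^d)$ be the nets in $\mathcal E[\mathbb R^d]$ such that for all $\alpha,\beta\in\mathbb N^d$ and $q\in\mathbb N$, $\sup_{\epsilon\in(0,1]}\epsilon^{-q}\|x^\alpha\partial^\beta u_\epsilon\|_{L^\infty}<\infty$; * $\mathcal G_{\tau,\mathcal S}(\mathbb R^d)=\mathcal E_\tau(\mathbb R^d)/\mathcal N_{\mathcal S}(\mathbb R^d)$; * $\mathcal G^\infty_{\mathcal S}(\mathbb R^d)\subset\mathcal G_{\tau,\mathcal S}(\mathbb R^d)$ be the set of classes having a representative for which there is $N\in\mathbb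 N$ such that for all $\alpha,\beta\in\mathbb N^d$, $\sup_{\epsilon\in(0,1]}\epsilon^{N}\|x^\alpha\partial^\beta u_\epsilon\|_{L^\infty}<\infty$. Fix $n$ and a mollifier $\varphi\in\mathcal S(\mathbb R^n)$, i.e. $\int\varphi=1$ and $\int x^\alpha\varphi(x)\,dx=0$ for all $\alpha\ne0$; put $\varphi_\epsilon(x)=\epsilon^{-n}\varphi(x/\epsilon)$ and $\widehat{\varphi_\epsilon}(y)=\int e^{-ixy}\varphi_\epsilon(x)\,dx$. A weight function is a continuous $\Lambda:\mathbb R^{2n}\to\mathbb R$ such that, for some $\mu>0$ and suitable positive constants $c$: (i) $\langle z\rangle^\mu\le c\,\Lambda(z)$ and $\Lambda(z)\le c\,\langle z\rangle$ for all $z$; (ii) $\Lambda(z)\le c\,\Lambda(\zeta)$ and $\Lambda(\zeta)\le c\,\Lambda(z)$ whenever $|\zeta-z|\le\mu\Lambda(z)$; (iii) for every $t\in\mathbb R^{2n}$ there is $c$ with $\Lambda(t_1z_1,\dots,t_{2n}z_{2n})\le c\,\Lambda(z)$ for all $z$. For a weight function $\Lambda$ and $\rho\in(0,1]$ let $\mathcal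 S^m_{\Lambda,\rho,N}$ ($m\in\mathbb R$, $N\in\mathbb N$) be the set of $(a_\epsilon)_\epsilon\in\mathcal E[\mathbb R^{2n}]$ such that for every $\alpha\in\mathbb N^{2n}$ there is $c>0$ with $|\partial^\alpha a_\epsilon(z)|\le c\,\Lambda(z)^{m-\rho|\alpha|}\epsilon^{-N}$ for all $\epsilon\in(0,1]$ and $z\in\mathbb R^{2n}$. The smoothing symbols are the elements of $\mathcal S^{-\infty}=\bigcup_{N\in\mathbb N}\bigcap_{m\in\mathbb R}\mathcal S^m_{\Lambda,\rho,N}$. Let $A:\mathcal G_{\tau,\mathcal S}(\mathbb R^n)\to\mathcal G_{\tau,\mathcal S}(\mathbb R^n)$ be a linear map. * $A$ is an *operator with $\mathcal S$-regular kernel* if there is $k_A\in\mathcal G^\infty_{\mathcal S}(\mathbb R^{2n})$ such that $Au=\int_{\mathbb R^n}k_A(\cdot,y)u(y)\,dy$ for all $u$, where the right-hand side is the class of $\int_{\mathbb R^n}k_{A,\epsilon}(x,y)u_\epsilon(y)\widehat{\varphi_\epsilon}(y)\,dy$, for any representatives of $k_A$ and $u$. * $A$ is the *pseudo-differential operator with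 symbol* $(a_\epsilon)_\epsilon$ if, for every $u$ and every representative $(u_\epsilon)_\epsilon$ of $u$, $Au$ is the class of $$A_\epsilon u_\epsilon(x)=(2\pi)^{-n}\int_{\mathbb R^{2n}}e^{i(x-y)\xi}a_\epsilon(x,\xi)u_\epsilon(y)\widehat{\varphi_\epsilon}(y)\,dy\,d\xi ,$$ the integral being understood as an oscillatory integral (insert a factor $\psi(hy,h\xi)$ with $\psi\in\mathcal S(\mathbb R^{2n})$, $\psi(0)=1$, and let $h\to0^+$; the limit does not depend on $\psi$). **Proposition.** For every weight function $\Lambda$ and every $\rho\in(0,1]$, a linear map $A:\mathcal G_{\tau,\mathcal S}(\mathbb R^n)\to\mathcal G_{\tau,\mathcal S}(\mathbb R^n)$ is an operator with $\mathcal S$-regular kernel if and only if it is the pseudo-differential operator with symbol $(a_\epsilon)_\epsilon$ for some smoothing symbol $(a_\epsilon)_\epsilon\in\mathcal S^{-\infty}$. -/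

import Mathlib

open scoped ContDiff SchwartzMap Topology

noncomputable section

namespace Colombeau

/-- The Euclidean space of dimension `n`. The space of dimension `2n` is `Rn n × Rn n`; its product
norm is equivalent to the Euclidean norm, and the estimates on it below, whose constants may depend
on the orders involved, are insensitive to the choice between the two. -/
abbrev Rn (n : ℕ) : Type := EuclideanSpace ℝ (Fin n)

/-- The range `(0,1]` of the parameter `ε`. -/
abbrev Eps : Type := Set.Ioc (0 : ℝ) 1

/-- The bracket `⟨x⟩ = (1 + |x|^2)^(1/2)`. -/
def bracket {V : Type*} [NormedAddCommGroup V] (x : V) : ℝ := Real.sqrt (1 + ‖x‖ ^ 2)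

theorem one_le_bracket {V : Type*} [NormedAddCommGroup V] (x : V) : 1 ≤ bracket x := by
  unfold bracket
  rw [Real.one_le_sqrt]
  nlinarith [sq_nonneg ‖x‖]

section Spaces

variable (V : Type*) [NormedAddCommGroup V] [NormedSpace ℝ V]

/-- `𝓔[V]`: nets of smooth functions. As for Mathlib's Schwartz functions, the size of all partial
derivatives of order `k` is measured by the norm of the `k`-th iterated derivative. -/
def SmoothNets : Submodule ℂ (Eps → V → ℂ) where
  carrier := {u | ∀ ε, ContDiff ℝ ∞ (u ε)}
  add_mem' hu hv ε := (hu ε).add (hv ε)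
  zero_mem' _ := contDiff_const
  smul_mem' c _ hu ε := ContDiff.const_smul c (hu ε)

variable {V} in
theorem SmoothNets.contDiffAt {u : Eps → V → ℂ} (hu : u ∈ SmoothNets V) (ε : Eps) (k : ℕ) (x : V) :
    ContDiffAt ℝ k (u ε) x :=
  (ContDiff.of_le (show ContDiff ℝ ∞ (u ε) from hu ε) (by exact_mod_cast le_top)).contDiffAt

variable {V} in
theorem SmoothNets.norm_iteratedFDeriv_add_le {u v : Eps → V → ℂ} (hu : u ∈ SmoothNets V)
    (hv : v ∈ SmoothNets V) (ε : Eps) (k : ℕ) (x : V) :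
    ‖iteratedFDeriv ℝ k ((u + v) ε) x‖ ≤
      ‖iteratedFDeriv ℝ k (u ε) x‖ + ‖iteratedFDeriv ℝ k (v ε) x‖ := by
  rw [Pi.add_apply, iteratedFDeriv_add_apply (contDiffAt hu ε k x) (contDiffAt hv ε k x)]
  exact norm_add_le _ _

variable {V} in
theorem SmoothNets.norm_iteratedFDeriv_smul {u : Eps → V → ℂ} (hu : u ∈ SmoothNets V)
    (c : ℂ) (ε : Eps) (k : ℕ) (x : V) :
    ‖iteratedFDeriv ℝ k ((c • u) ε) x‖ = ‖c‖ * ‖iteratedFDeriv ℝ k (u ε) x‖ := by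
  rw [Pi.smul_apply, iteratedFDeriv_const_smul_apply (contDiffAt hu ε k x), norm_smul]

/-- `𝓔_τ(V)`: for all `k` there is `N` with
`sup_ε ε^N ‖⟨x⟩^(-N) ∂^k u_ε‖_∞ < ∞`. -/
def Tempered : Submodule ℂ (Eps → V → ℂ) where
  carrier := {u | u ∈ SmoothNets V ∧ ∀ k : ℕ, ∃ N : ℕ, ∃ C : ℝ, ∀ (ε : Eps) (x : V),
    (ε : ℝ) ^ N * ‖iteratedFDeriv ℝ k (u ε) x‖ ≤ C * bracket x ^ N}
  add_mem' := by
    rintro u v ⟨hu, hu2⟩ ⟨hv, hv2⟩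
    refine ⟨add_mem hu hv, fun k => ?_⟩
    obtain ⟨N, C, h⟩ := hu2 k
    obtain ⟨M, D, h2⟩ := hv2 k
    refine ⟨N + M, |C| + |D|, fun ε x => ?_⟩
    have e0 : (0 : ℝ) ≤ ε := ε.2.1.le
    have e1 : ∀ m : ℕ, (ε : ℝ) ^ m ≤ 1 := fun m => pow_le_one₀ e0 ε.2.2
    have b1 : ∀ m : ℕ, 1 ≤ bracket x ^ m := fun m => one_le_pow₀ (one_le_bracket x)
    have hA : (ε : ℝ) ^ (N + M) * ‖iteratedFDeriv ℝ k (u ε) x‖ ≤ |C| * bracket x ^ (N + M) := by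
      calc (ε : ℝ) ^ (N + M) * ‖iteratedFDeriv ℝ k (u ε) x‖
          = ε ^ M * (ε ^ N * ‖iteratedFDeriv ℝ k (u ε) x‖) := by ring
        _ ≤ 1 * (ε ^ N * ‖iteratedFDeriv ℝ k (u ε) x‖) := by gcongr; exact e1 M
        _ ≤ C * bracket x ^ N := by rw [one_mul]; exact h ε x
        _ ≤ |C| * bracket x ^ (N + M) := by
          gcongr
          · exact (zero_le_one.trans (b1 N))
          · exact le_abs_self C
          · exact one_le_bracket x
          · exact Nat.le_add_right _ _
    have hB : (ε : ℝ) ^ (N + M) * ‖iteratedFDeriv ℝ k (v ε) x‖ ≤ |D| * bracket x ^ (N + M) := by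
      calc (ε : ℝ) ^ (N + M) * ‖iteratedFDeriv ℝ k (v ε) x‖
          = ε ^ N * (ε ^ M * ‖iteratedFDeriv ℝ k (v ε) x‖) := by ring
        _ ≤ 1 * (ε ^ M * ‖iteratedFDeriv ℝ k (v ε) x‖) := by gcongr; exact e1 N
        _ ≤ D * bracket x ^ M := by rw [one_mul]; exact h2 ε x
        _ ≤ |D| * bracket x ^ (N + M) := by
          gcongr
          · exact (zero_le_one.trans (b1 M))
          · exact le_abs_self D
          · exact one_le_bracket x
          · exact Nat.le_add_left _ _
    calc (ε : ℝ) ^ (N + M) * ‖iteratedFDeriv ℝ k ((u + v) ε) x‖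
        ≤ ε ^ (N + M) * (‖iteratedFDeriv ℝ k (u ε) x‖ + ‖iteratedFDeriv ℝ k (v ε) x‖) := by
          gcongr; exact SmoothNets.norm_iteratedFDeriv_add_le hu hv ε k x
      _ ≤ (|C| + |D|) * bracket x ^ (N + M) := by rw [mul_add, add_mul]; exact add_le_add hA hB
  zero_mem' := by
    refine ⟨zero_mem _, fun k => ⟨0, 0, fun ε x => ?_⟩⟩
    simp
  smul_mem' := by
    rintro c u ⟨hu, hu2⟩
    refine ⟨Submodule.smul_mem _ c hu, fun k => ?_⟩
    obtain ⟨N, C, h⟩ := hu2 k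
    refine ⟨N, ‖c‖ * C, fun ε x => ?_⟩
    rw [SmoothNets.norm_iteratedFDeriv_smul hu]
    calc (ε : ℝ) ^ N * (‖c‖ * ‖iteratedFDeriv ℝ k (u ε) x‖)
        = ‖c‖ * (ε ^ N * ‖iteratedFDeriv ℝ k (u ε) x‖) := by ring
      _ ≤ ‖c‖ * (C * bracket x ^ N) := mul_le_mul_of_nonneg_left (h ε x) (norm_nonneg c)
      _ = ‖c‖ * C * bracket x ^ N := by ring

/-- `𝓝_𝓢(V)`: for all orders `j, k` and all `q`,
`sup_ε ε^(-q) ‖ |x|^j ∂^k u_ε ‖_∞ < ∞`. -/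
def Negligible : Submodule ℂ (Eps → V → ℂ) where
  carrier := {u | u ∈ SmoothNets V ∧ ∀ j k q : ℕ, ∃ C : ℝ, ∀ (ε : Eps) (x : V),
    ‖x‖ ^ j * ‖iteratedFDeriv ℝ k (u ε) x‖ ≤ C * (ε : ℝ) ^ q}
  add_mem' := by
    rintro u v ⟨hu, hu2⟩ ⟨hv, hv2⟩
    refine ⟨add_mem hu hv, fun j k q => ?_⟩
    obtain ⟨C, h⟩ := hu2 j k q
    obtain ⟨D, h2⟩ := hv2 j k q
    refine ⟨C + D, fun ε x => ?_⟩
    calc ‖x‖ ^ j * ‖iteratedFDeriv ℝ k ((u + v) ε) x‖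
        ≤ ‖x‖ ^ j * (‖iteratedFDeriv ℝ k (u ε) x‖ + ‖iteratedFDeriv ℝ k (v ε) x‖) := by
          gcongr; exact SmoothNets.norm_iteratedFDeriv_add_le hu hv ε k x
      _ ≤ (C + D) * (ε : ℝ) ^ q := by
          rw [mul_add, add_mul]; exact add_le_add (h ε x) (h2 ε x)
  zero_mem' := by
    refine ⟨zero_mem _, fun j k q => ⟨0, fun ε x => ?_⟩⟩
    simp
  smul_mem' := by
    rintro c u ⟨hu, hu2⟩
    refine ⟨Submodule.smul_mem _ c hu, fun j k q => ?_⟩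
    obtain ⟨C, h⟩ := hu2 j k q
    refine ⟨‖c‖ * C, fun ε x => ?_⟩
    rw [SmoothNets.norm_iteratedFDeriv_smul hu]
    calc ‖x‖ ^ j * (‖c‖ * ‖iteratedFDeriv ℝ k (u ε) x‖)
        = ‖c‖ * (‖x‖ ^ j * ‖iteratedFDeriv ℝ k (u ε) x‖) := by ring
      _ ≤ ‖c‖ * (C * (ε : ℝ) ^ q) := mul_le_mul_of_nonneg_left (h ε x) (norm_nonneg c)
      _ = ‖c‖ * C * (ε : ℝ) ^ q := by ring

theorem negligible_le_tempered : Negligible V ≤ Tempered V := by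
  rintro u ⟨hu, h⟩
  refine ⟨hu, fun k => ?_⟩
  obtain ⟨C, hC⟩ := h 0 k 0
  exact ⟨0, C, fun ε x => by simpa using hC ε x⟩

/-- `𝓖_{τ,𝓢}(V) = 𝓔_τ(V) / 𝓝_𝓢(V)`. -/
abbrev GtauS : Type _ := Tempered V ⧸ (Negligible V).submoduleOf (Tempered V)

variable {V}

/-- The class in `𝓖_{τ,𝓢}(V)` of a net in `𝓔_τ(V)`. -/
def GtauS.mk (u : Tempered V) : GtauS V := Submodule.Quotient.mk u

/-- The estimate defining `𝓔^∞_𝓢(V)`: there is `N` such that for all orders `j, k`,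
`sup_ε ε^N ‖ |x|^j ∂^k u_ε ‖_∞ < ∞`. -/
def IsSRegularNet (u : Eps → V → ℂ) : Prop :=
  u ∈ SmoothNets V ∧ ∃ N : ℕ, ∀ j k : ℕ, ∃ C : ℝ, ∀ (ε : Eps) (x : V),
    (ε : ℝ) ^ N * (‖x‖ ^ j * ‖iteratedFDeriv ℝ k (u ε) x‖) ≤ C

variable (V) in
/-- `𝓖^∞_𝓢(V)`: the classes that have a representative in `𝓔^∞_𝓢(V)`. -/
def SRegular : Set (GtauS V) := {w | ∃ u : Tempered V, GtauS.mk u = w ∧ IsSRegularNet u.1}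

end Spaces

variable {n : ℕ}

/-- A mollifier: a Schwartz function with integral one, all of whose higher moments vanish. -/
def IsMollifier (φ : 𝓢(Rn n, ℂ)) : Prop :=
  ∫ x, φ x = 1 ∧ ∀ α : Fin n → ℕ, α ≠ 0 → ∫ x : Rn n, ((∏ i, x i ^ α i : ℝ) : ℂ) * φ x = 0

/-- `φ_ε(x) = ε^(-n) φ(x / ε)`. -/
def scaled (φ : 𝓢(Rn n, ℂ)) (ε : Eps) (x : Rn n) : ℂ :=
  (((ε : ℝ) ^ n)⁻¹ : ℝ) * φ ((ε : ℝ)⁻¹ • x)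

/-- The Fourier transform of `φ_ε`, that is `∫ e^(-i x·y) φ_ε(x) dx`. -/
def scaledHat (φ : 𝓢(Rn n, ℂ)) (ε : Eps) (y : Rn n) : ℂ :=
  ∫ x : Rn n, Complex.exp (-Complex.I * (inner ℝ x y : ℝ)) * scaled φ ε x

/-- `A` is an operator with `𝓢`-regular kernel: there is `k_A` in `𝓖^∞_𝓢(ℝ^{2n})` with
`A u = ∫ k_A(·, y) u(y) dy` for all `u`. The generalized function on the right is the class of the
net `∫ k_ε(x,y) u_ε(y) (φ_ε)^(y) dy`, for any representatives of `k_A` and `u`. -/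
def HasSRegularKernel (φ : 𝓢(Rn n, ℂ)) (A : GtauS (Rn n) →ₗ[ℂ] GtauS (Rn n)) : Prop :=
  ∃ kA ∈ SRegular (Rn n × Rn n),
    ∀ k : Tempered (Rn n × Rn n), GtauS.mk k = kA → ∀ u : Tempered (Rn n),
      ∃ v : Tempered (Rn n),
        (∀ ε x, v.1 ε x = ∫ y : Rn n, k.1 ε (x, y) * u.1 ε y * scaledHat φ ε y) ∧
        A (GtauS.mk u) = GtauS.mk v

/-- The Euclidean norm on the space of dimension `2n`. -/
def euclNorm (z : Rn n × Rn n) : ℝ := Real.sqrt (‖z.1‖ ^ 2 + ‖z.2‖ ^ 2)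

/-- The bracket `(1 + |z|^2)^(1/2)` with the Euclidean norm on the space of dimension `2n`. -/
def euclBracket (z : Rn n × Rn n) : ℝ := Real.sqrt (1 + euclNorm z ^ 2)

/-- Coordinatewise product `(t₁ z₁, …, t_{2n} z_{2n})`. -/
def coordMul (t z : Rn n × Rn n) : Rn n × Rn n :=
  (WithLp.toLp 2 fun i => t.1 i * z.1 i, WithLp.toLp 2 fun i => t.2 i * z.2 i)

/-- Weight functions on the space of dimension `2n`. -/
def IsWeight (Λ : Rn n × Rn n → ℝ) : Prop :=
  Continuous Λ ∧
  (∃ μ : ℝ, 0 < μ ∧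
    (∃ c : ℝ, 0 < c ∧ ∀ z, euclBracket z ^ μ ≤ c * Λ z) ∧
    (∃ c : ℝ, 0 < c ∧ ∀ z, Λ z ≤ c * euclBracket z) ∧
    (∃ c : ℝ, 0 < c ∧ ∀ z ζ, euclNorm (ζ - z) ≤ μ * Λ z → Λ z ≤ c * Λ ζ ∧ Λ ζ ≤ c * Λ z)) ∧
  ∀ t, ∃ c : ℝ, 0 < c ∧ ∀ z, Λ (coordMul t z) ≤ c * Λ z

/-- `𝓢^m_{Λ,ρ,N}`: regular symbols. -/
def Symbols (Λ : Rn n × Rn n → ℝ) (ρ m : ℝ) (N : ℕ) : Set (Eps → Rn n × Rn n → ℂ) :=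
  {a | a ∈ SmoothNets (Rn n × Rn n) ∧ ∀ k : ℕ, ∃ c : ℝ, 0 < c ∧ ∀ (ε : Eps) (z : Rn n × Rn n),
    ‖iteratedFDeriv ℝ k (a ε) z‖ ≤ c * Λ z ^ (m - ρ * k) * ((ε : ℝ) ^ N)⁻¹}

/-- `𝓢^{-∞} = ⋃_N ⋂_m 𝓢^m_{Λ,ρ,N}`: smoothing symbols. -/
def SmoothingSymbols (Λ : Rn n × Rn n → ℝ) (ρ : ℝ) : Set (Eps → Rn n × Rn n → ℂ) :=
  ⋃ N : ℕ, ⋂ m : ℝ, Symbols Λ ρ m N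

/-- `I` is the oscillatory integral `∫ e^{iθ(z)} b(z) dz`: the limit, as `h → 0+`, of the absolutely
convergent integrals `∫ e^{iθ(z)} b(z) ψ(hz) dz`, for every Schwartz function `ψ` with
`ψ(0) = 1`. -/
def IsOscIntegral (θ : Rn n × Rn n → ℝ) (b : Rn n × Rn n → ℂ) (I : ℂ) : Prop :=
  ∀ ψ : 𝓢(Rn n × Rn n, ℂ), ψ 0 = 1 →
    (∀ h : ℝ, 0 < h → MeasureTheory.Integrable
      fun z => Complex.exp (Complex.I * θ z) * b z * ψ (h • z)) ∧
    Filter.Tendsto (fun h : ℝ => ∫ z, Complex.exp (Complex.I * θ z) * b z * ψ (h • z))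
      (𝓝[>] 0) (𝓝 I)

/-- `A` is the pseudo-differential operator with amplitude `(a_ε(x,y,ξ))_ε`: the image of the class
of `(u_ε)_ε` is the class of the net given by the oscillatory integrals
`∫ e^{i(x-y)ξ} a_ε(x,y,ξ) u_ε(y) (φ_ε)^(y) dy dξ / (2π)^n`, with phase `-y·ξ` in `(y,ξ)`. -/
def IsPseudoDiffOp (φ : 𝓢(Rn n, ℂ)) (a : Eps → Rn n → Rn n → Rn n → ℂ)
    (A : GtauS (Rn n) →ₗ[ℂ] GtauS (Rn n)) : Prop :=
  ∀ u : Tempered (Rn n), ∃ v : Tempered (Rn n),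
    (∀ ε x, IsOscIntegral (fun z => -inner ℝ z.1 z.2)
      (fun z => (((2 * Real.pi) ^ n)⁻¹ : ℝ) * (Complex.exp (Complex.I * (inner ℝ x z.2 : ℝ)) *
        a ε x z.1 z.2 * u.1 ε z.1 * scaledHat φ ε z.1)) (v.1 ε x)) ∧
    A (GtauS.mk u) = GtauS.mk v

end Colombeau

end

/-! On both sides the data are the same objects: nets of Schwartz functions on the product space
which, multiplied by one power of `ε`, form a bounded set. For kernels this is the definition; for
symbols it is `mem_smoothingSymbols_iff`, which holds because a weight lies between a positive power
of the bracket and a multiple of the bracket, so that decay in `Λ` of every order is rapid decay.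

Kernel and symbol determine each other by k(x,y) = (2π)^(-n) ∫ e^(i(x-y)·ξ) a(x,ξ) dξ, a partial
Fourier transform in the second variable between two linear changes of coordinates. Such a map sends
bounded sets of Schwartz functions to bounded sets (`isVonNBounded_image_partialFourier`), hence
preserves the exponent of `ε`. Since `u_ε (φ_ε)^` is integrable and `a` is Schwartz, the oscillatory
integral converges absolutely, and Fubini turns it into the integral operator with kernel `k`
(`isOscIntegral_kernelOfSymbol`).

What remains is independence of the representative of the kernel: a negligible kernel applied to a
tempered net yields a negligible net (`integral_mem_negligible`). -/

noncomputable section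

namespace Colombeau

open MeasureTheory Bornology Filter
open scoped FourierTransform

/-! ### Bounded sets of Schwartz functions -/

section BoundedSets

variable {V E : Type*} [NormedAddCommGroup V] [NormedSpace ℝ V] [NormedAddCommGroup E]
  [NormedSpace ℝ E]

/-- A set of Schwartz functions is bounded iff every Schwartz seminorm is bounded on it. -/
theorem isVonNBounded_schwartz_iff {S : Set 𝓢(V, E)} :
    IsVonNBounded ℝ S ↔ ∀ j k : ℕ, ∃ C : ℝ, ∀ f ∈ S, ∀ x,
      ‖x‖ ^ j * ‖iteratedFDeriv ℝ k f x‖ ≤ C := by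
  rw [(schwartz_withSeminorms ℝ V E).isVonNBounded_iff_seminorm_bounded]
  constructor
  · intro h j k
    obtain ⟨r, -, hr⟩ := h (j, k)
    exact ⟨r, fun f hf x => (SchwartzMap.le_seminorm ℝ j k f x).trans (hr f hf).le⟩
  · rintro h ⟨j, k⟩
    obtain ⟨C, hC⟩ := h j k
    refine ⟨|C| + 1, by positivity, fun f hf => ?_⟩
    refine lt_of_le_of_lt (SchwartzMap.seminorm_le_bound ℝ j k f (abs_nonneg C)
      fun x => (hC f hf x).trans (le_abs_self C)) (lt_add_one _)

/-- On a bounded set of Schwartz functions the weight `(1 + ‖x‖) ^ N` is uniformly absorbed. -/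
theorem exists_one_add_norm_pow_mul_le {S : Set 𝓢(V, E)} (hS : IsVonNBounded ℝ S) (N : ℕ) :
    ∃ C : ℝ, ∀ f ∈ S, ∀ x, (1 + ‖x‖) ^ N * ‖f x‖ ≤ C := by
  obtain ⟨r, -, hr⟩ := (schwartz_withSeminorms ℝ V E).isVonNBounded_iff_finset_seminorm_bounded.1
    hS (Finset.Iic (N, 0))
  refine ⟨2 ^ N * r, fun f hf x => ?_⟩
  have := SchwartzMap.one_add_le_sup_seminorm_apply (𝕜 := ℝ) (m := (N, 0)) le_rfl le_rfl f x
  rw [norm_iteratedFDeriv_zero] at this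
  exact this.trans (by gcongr; exact (hr f hf).le)

end BoundedSets

/-! ### Slices of Schwartz functions on a product -/

section Slices

variable {X W E : Type*} [NormedAddCommGroup X] [NormedSpace ℝ X] [NormedAddCommGroup W]
  [NormedSpace ℝ W] [NormedAddCommGroup E] [NormedSpace ℝ E]

/-- The slice is a translate of `f` composed with the inclusion of the second factor, whose operator
norm is at most one. -/
theorem norm_iteratedFDeriv_comp_prodMk_right_le {f : X × W → E} {k : ℕ} (hf : ContDiff ℝ k f)
    (x : X) (w : W) :
    ‖iteratedFDeriv ℝ k (fun w => f (x, w)) w‖ ≤ ‖iteratedFDeriv ℝ k f (x, w)‖ := by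
  have e : (fun w => f (x, w)) = (fun z => f ((x, 0) + z)) ∘ ContinuousLinearMap.inr ℝ X W := by
    ext w; simp
  have hg : ContDiff ℝ k (fun z => f ((x, 0) + z)) := hf.comp (contDiff_const.add contDiff_id)
  rw [e, ContinuousLinearMap.iteratedFDeriv_comp_right _ hg w le_rfl, iteratedFDeriv_comp_add_left]
  have e2 : (x, 0) + ContinuousLinearMap.inr ℝ X W w = (x, w) := by simp
  rw [e2]
  refine (ContinuousMultilinearMap.norm_compContinuousLinearMap_le _ _).trans ?_
  refine mul_le_of_le_one_right (norm_nonneg _) ?_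
  exact Finset.prod_le_one (fun _ _ => norm_nonneg _)
    fun _ _ => ContinuousLinearMap.norm_inr_le_one ℝ X W

/-- The restriction of a Schwartz function on a product to a slice. -/
def slice (x : X) (f : 𝓢(X × W, E)) : 𝓢(W, E) where
  toFun w := f (x, w)
  smooth' := (f.smooth ⊤).comp (contDiff_const.prodMk contDiff_id)
  decay' j k := by
    obtain ⟨C, hC⟩ := f.decay' j k
    refine ⟨C, fun w => le_trans ?_ (hC (x, w))⟩
    gcongr
    · exact norm_snd_le (x, w)
    · exact norm_iteratedFDeriv_comp_prodMk_right_le (f.smooth k) x w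

@[simp]
theorem slice_apply (x : X) (f : 𝓢(X × W, E)) (w : W) : slice x f w = f (x, w) := rfl

/-- The slices of a bounded set of Schwartz functions decay rapidly in the base point. -/
theorem isVonNBounded_slices {S : Set 𝓢(X × W, E)} (hS : IsVonNBounded ℝ S) (l : ℕ) :
    IsVonNBounded ℝ {g : 𝓢(W, E) | ∃ f ∈ S, ∃ x : X, g = (‖x‖ ^ l) • slice x f} := by
  rw [isVonNBounded_schwartz_iff] at hS ⊢
  intro j k
  obtain ⟨C, hC⟩ := hS (l + j) k
  refine ⟨C, ?_⟩
  rintro _ ⟨f, hf, x, rfl⟩ w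
  refine le_trans ?_ (hC f hf (x, w))
  have e : ⇑((‖x‖ ^ l) • slice x f) = (‖x‖ ^ l) • ⇑(slice x f) := rfl
  rw [e, iteratedFDeriv_const_smul_apply ((slice x f).contDiffAt k), norm_smul, pow_add]
  simp only [norm_pow, norm_norm]
  calc ‖w‖ ^ j * (‖x‖ ^ l * ‖iteratedFDeriv ℝ k (slice x f) w‖)
      = ‖x‖ ^ l * ‖w‖ ^ j * ‖iteratedFDeriv ℝ k (slice x f) w‖ := by ring
    _ ≤ ‖(x, w)‖ ^ l * ‖(x, w)‖ ^ j * ‖iteratedFDeriv ℝ k f (x, w)‖ := by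
      gcongr ?_ ^ l * ?_ ^ j * ?_
      · exact norm_fst_le (x, w)
      · exact norm_snd_le (x, w)
      · exact norm_iteratedFDeriv_comp_prodMk_right_le (f.smooth k) x w

/-- A uniform integrable bound, after weighting, for the slices of a bounded set of Schwartz
functions. -/
theorem exists_integrable_bound_slices [MeasurableSpace W] (μ : Measure W)
    [μ.HasTemperateGrowth] {S : Set 𝓢(X × W, E)} (hS : IsVonNBounded ℝ S) (j N : ℕ) :
    ∃ B : W → ℝ, Integrable B μ ∧ ∀ f ∈ S, ∀ x w,
      ‖x‖ ^ j * ((1 + ‖w‖) ^ N * ‖f (x, w)‖) ≤ B w := by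
  obtain ⟨p, hp⟩ := Measure.HasTemperateGrowth.exists_integrable (μ := μ)
  -- The powers `j` and `N` pay for the two weights; the surplus `p` is traded for the integrable
  -- factor `(1 + ‖w‖) ^ (-p)`.
  obtain ⟨C, hC⟩ := exists_one_add_norm_pow_mul_le hS (j + N + p)
  refine ⟨fun w => (1 + ‖w‖) ^ (-(p : ℝ)) * C, hp.mul_const C, fun f hf x w => ?_⟩
  beta_reduce
  rw [Real.rpow_neg (by positivity), ← div_eq_inv_mul, le_div_iff₀' (by positivity),
    Real.rpow_natCast]
  refine le_trans ?_ (hC f hf (x, w))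
  calc (1 + ‖w‖) ^ p * (‖x‖ ^ j * ((1 + ‖w‖) ^ N * ‖f (x, w)‖))
      = ‖x‖ ^ j * (1 + ‖w‖) ^ N * (1 + ‖w‖) ^ p * ‖f (x, w)‖ := by ring
    _ ≤ (1 + ‖(x, w)‖) ^ j * (1 + ‖(x, w)‖) ^ N * (1 + ‖(x, w)‖) ^ p * ‖f (x, w)‖ := by
      have h1 : ‖x‖ ≤ 1 + ‖(x, w)‖ := (norm_fst_le (x, w)).trans (by linarith)
      have h2 : ‖w‖ ≤ ‖(x, w)‖ := norm_snd_le (x, w)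
      gcongr
    _ = _ := by rw [← pow_add, ← pow_add]

end Slices

/-! ### The Fourier transform in the second variable -/

section PartialFourier

universe u

variable {X W : Type u} [NormedAddCommGroup X] [NormedSpace ℝ X]
  [NormedAddCommGroup W] [InnerProductSpace ℝ W] [FiniteDimensional ℝ W] [MeasurableSpace W]
  [BorelSpace W]

section Definitions

variable {E : Type u} [NormedAddCommGroup E] [NormedSpace ℝ E] [NormedSpace ℂ E]
  [IsScalarTower ℝ ℂ E]

/-- The Fourier transform in the second variable, as a function. -/
def partialFourierFun (f : 𝓢(X × W, E)) (z : X × W) : E :=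
  ∫ w, (Real.fourierChar (-inner ℝ w z.2) : ℂ) • f (z.1, w)

theorem partialFourierFun_eq_fourier {E : Type u} [NormedAddCommGroup E] [NormedSpace ℂ E]
    (f : 𝓢(X × W, E)) (z : X × W) : partialFourierFun f z = 𝓕 (slice z.1 f) z.2 := by
  rw [SchwartzMap.fourier_coe, Real.fourier_eq]
  rfl

variable (X W E) in
/-- The operator on Schwartz functions induced by the derivative of the partial Fourier
transform. -/
def partialFourierDeriv : 𝓢(X × W, E) →L[ℝ] 𝓢(X × W, X × W →L[ℝ] E) :=
  (SchwartzMap.postcompCLM ((ContinuousLinearMap.compL ℝ (X × W) (X × W) E).flip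
      ((ContinuousLinearMap.inl ℝ X W).comp (ContinuousLinearMap.fst ℝ X W)))).comp
    (SchwartzMap.fderivCLM ℝ (X × W) E) +
  (-(2 * Real.pi * Complex.I)) • SchwartzMap.smulRightCLM ℝ E
    ((innerSL ℝ (E := W)).bilinearComp (ContinuousLinearMap.snd ℝ X W)
      (ContinuousLinearMap.snd ℝ X W))

theorem hasFDerivAt_fourierChar_smul_slice (f : 𝓢(X × W, E)) (w : W) (z : X × W) :
    HasFDerivAt (fun z : X × W => (Real.fourierChar (-inner ℝ w z.2) : ℂ) • f (z.1, w))
      ((Real.fourierChar (-inner ℝ w z.2) : ℂ) • partialFourierDeriv X W E f (z.1, w)) z := by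
  have h1 : HasFDerivAt (fun z : X × W => f (z.1, w))
      ((fderiv ℝ f (z.1, w)).comp
        ((ContinuousLinearMap.inl ℝ X W).comp (ContinuousLinearMap.fst ℝ X W))) z := by
    have : HasFDerivAt (fun z : X × W => (z.1, w))
        ((ContinuousLinearMap.inl ℝ X W).comp (ContinuousLinearMap.fst ℝ X W)) z := by
      convert! (hasFDerivAt_fst (𝕜 := ℝ) (p := z)).prodMk (hasFDerivAt_const w z) using 1
    exact (f.differentiableAt.hasFDerivAt (x := (z.1, w))).comp z this
  have hlin : HasFDerivAt (fun z : X × W => -inner ℝ w z.2)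
      (-((innerSL ℝ w).comp (ContinuousLinearMap.snd ℝ X W))) z :=
    ((innerSL ℝ w).comp (ContinuousLinearMap.snd ℝ X W)).hasFDerivAt.neg
  have h2 := (Real.hasDerivAt_fourierChar (-inner ℝ w z.2)).hasFDerivAt.comp z hlin
  have h3 := h2.smul h1
  refine h3.congr_fderiv ?_
  ext v
  · simp [partialFourierDeriv]
  · simp only [partialFourierDeriv, ContinuousLinearMap.smulRight_apply,
      ContinuousLinearMap.comp_apply, add_apply, smul_apply, SchwartzMap.postcompCLM_apply]
    simp
    rw [← algebraMap_smul ℂ (inner ℝ w v) (f (z.1, w)), Complex.coe_algebraMap, smul_smul,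
      smul_smul]
    congr 1
    ring

/-- The derivative is again a partial Fourier transform of a Schwartz function, with values in a
space of linear maps. Smoothness and decay of all derivatives then follow by induction on the order
with the target space `E` varying, which is why `X`, `W` and `E` share a universe. Differentiation
under the integral is allowed since the character is unimodular and Schwartz slices have a common
integrable bound. -/
theorem hasFDerivAt_partialFourierFun (f : 𝓢(X × W, E)) (z : X × W) :
    HasFDerivAt (partialFourierFun f) (partialFourierFun (partialFourierDeriv X W E f) z) z := by
  have hcont : ∀ {F : Type u} [NormedAddCommGroup F] [NormedSpace ℝ F] [NormedSpace ℂ F]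
      (g : 𝓢(X × W, F)) (z : X × W), Continuous fun w => (Real.fourierChar (-inner ℝ w z.2) : ℂ) • g (z.1, w) := by
    intro F _ _ _ g z
    have : Continuous fun w => g (z.1, w) := g.continuous.comp (by fun_prop)
    have h2 : Continuous fun w => (Real.fourierChar (-inner ℝ w z.2) : ℂ) :=
      continuous_subtype_val.comp <| Real.continuous_fourierChar.comp (by fun_prop)
    exact h2.smul this
  obtain ⟨B, hB, hBf⟩ := exists_integrable_bound_slices (volume : Measure W)
    (isVonNBounded_singleton (𝕜 := ℝ) (partialFourierDeriv X W E f)) 0 0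
  refine hasFDerivAt_integral_of_dominated_of_fderiv_le univ_mem
    (Eventually.of_forall fun z => (hcont f z).aestronglyMeasurable) ?_
    (hcont _ z).aestronglyMeasurable (bound := B) ?_ hB
    (Eventually.of_forall fun w z _ => hasFDerivAt_fourierChar_smul_slice f w z)
  · refine (slice z.1 f).integrable.mono (hcont f z).aestronglyMeasurable
      (Eventually.of_forall fun w => ?_)
    rw [norm_smul, Circle.norm_coe, one_mul]
    rfl
  · refine Eventually.of_forall fun w z _ => ?_
    rw [norm_smul, Circle.norm_coe, one_mul]
    simpa using hBf _ rfl z.1 w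

end Definitions

theorem contDiff_nat_partialFourierFun (m : ℕ) :
    ∀ {E : Type u} [NormedAddCommGroup E] [NormedSpace ℝ E] [NormedSpace ℂ E]
  [IsScalarTower ℝ ℂ E] (f : 𝓢(X × W, E)),
      ContDiff ℝ m (partialFourierFun f) := by
  induction m with
  | zero =>
    intro E _ _ _ _ f
    rw [Nat.cast_zero, contDiff_zero]
    exact continuous_iff_continuousAt.2 fun z =>
      (hasFDerivAt_partialFourierFun f z).continuousAt
  | succ m ih =>
    intro E _ _ _ _ f
    rw [Nat.cast_succ, contDiff_succ_iff_hasFDerivAt]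
    exact ⟨_, ih (partialFourierDeriv X W E f), hasFDerivAt_partialFourierFun f⟩

/-- The induction carries independent real and complex structures on `E`, whereas the Fourier
transform on Schwartz space uses the real structure induced by the complex one; this reconciles
them. -/
theorem eq_complexToReal {E : Type*} [NormedAddCommGroup E] (i : NormedSpace ℝ E)
    (i' : NormedSpace ℂ E) [IsScalarTower ℝ ℂ E] : i = NormedSpace.complexToReal := by
  ext r x
  exact (algebraMap_smul ℂ r x).symm

/-- The slices multiplied by `‖x‖ ^ l` form a bounded set, and the Fourier transform, being
continuous and linear on Schwartz space, keeps it bounded; this gives decay in both variables at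
once. -/
theorem norm_partialFourierFun_le {E : Type u} [NormedAddCommGroup E] [NormedSpace ℂ E]
    {S : Set 𝓢(X × W, E)} (hS : IsVonNBounded ℝ S) (l m : ℕ) : ∃ C : ℝ, ∀ f ∈ S, ∀ z : X × W,
      ‖z.1‖ ^ l * ‖z.2‖ ^ m * ‖partialFourierFun f z‖ ≤ C := by
  obtain ⟨C, hC⟩ := isVonNBounded_schwartz_iff.1
    ((isVonNBounded_slices hS l).image (FourierTransform.fourierCLM ℝ 𝓢(W, E))) m 0
  refine ⟨C, fun f hf z => ?_⟩
  have := hC _ ⟨_, ⟨f, hf, z.1, rfl⟩, rfl⟩ z.2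
  rw [map_smul, norm_iteratedFDeriv_zero, smul_apply, norm_smul, norm_pow, norm_norm] at this
  refine le_trans (le_of_eq ?_) this
  rw [partialFourierFun_eq_fourier, FourierTransform.fourierCLM_apply]
  ring

theorem norm_iteratedFDeriv_partialFourierFun_le (k : ℕ) :
    ∀ {E : Type u} [NormedAddCommGroup E] [NormedSpace ℝ E] [NormedSpace ℂ E]
  [IsScalarTower ℝ ℂ E] {S : Set 𝓢(X × W, E)},
      IsVonNBounded ℝ S → ∀ j : ℕ, ∃ C : ℝ, ∀ f ∈ S, ∀ z,
        ‖z‖ ^ j * ‖iteratedFDeriv ℝ k (partialFourierFun f) z‖ ≤ C := by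
  induction k with
  | zero =>
    intro E _ i1 i2 _ S hS j
    obtain rfl := eq_complexToReal i1 i2
    have key := norm_partialFourierFun_le hS
    -- The norm on the product is a maximum, so it suffices to control the `j`-th power of each
    -- component separately.
    obtain ⟨C, hC⟩ := key j 0
    obtain ⟨D, hD⟩ := key 0 j
    refine ⟨max C D, fun f hf z => ?_⟩
    have h1 := hC f hf z
    have h2 := hD f hf z
    rw [norm_iteratedFDeriv_zero]
    rw [pow_zero, mul_one] at h1
    rw [pow_zero, one_mul] at h2
    rcases max_choice ‖z.1‖ ‖z.2‖ with h | h
    · rw [Prod.norm_def, h]; exact h1.trans (le_max_left _ _)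
    · rw [Prod.norm_def, h]; exact h2.trans (le_max_right _ _)
  | succ k ih =>
    intro E _ _ _ _ S hS j
    obtain ⟨C, hC⟩ := ih (hS.image (partialFourierDeriv X W E)) j
    refine ⟨C, fun f hf z => ?_⟩
    have e : fderiv ℝ (partialFourierFun f) = partialFourierFun (partialFourierDeriv X W E f) :=
      funext fun z => (hasFDerivAt_partialFourierFun f z).fderiv
    rw [← norm_iteratedFDeriv_fderiv, e]
    exact hC _ ⟨f, hf, rfl⟩ z

variable {E : Type u} [NormedAddCommGroup E] [NormedSpace ℂ E]

/-- The Fourier transform in the second variable of a Schwartz function on a product. -/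
def partialFourier (f : 𝓢(X × W, E)) : 𝓢(X × W, E) where
  toFun := partialFourierFun f
  smooth' := contDiff_infty.2 fun m => contDiff_nat_partialFourierFun m f
  decay' j k := by
    obtain ⟨C, hC⟩ := norm_iteratedFDeriv_partialFourierFun_le k
      (isVonNBounded_singleton (𝕜 := ℝ) f) j
    exact ⟨C, hC f rfl⟩

theorem partialFourier_apply (f : 𝓢(X × W, E)) (x : X) (ξ : W) :
    partialFourier f (x, ξ) = 𝓕 (slice x f) ξ :=
  partialFourierFun_eq_fourier f (x, ξ)

theorem slice_partialFourier (f : 𝓢(X × W, E)) (x : X) :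
    slice x (partialFourier f) = 𝓕 (slice x f) := by
  ext ξ
  exact partialFourier_apply f x ξ

theorem partialFourier_smul (c : ℝ) (f : 𝓢(X × W, E)) :
    partialFourier (c • f) = c • partialFourier f := by
  ext ⟨x, ξ⟩
  have : slice x (c • f) = c • slice x f := rfl
  rw [smul_apply, partialFourier_apply, partialFourier_apply, this,
    FourierTransform.fourier_smul, smul_apply]

theorem isVonNBounded_image_partialFourier {S : Set 𝓢(X × W, E)} (hS : IsVonNBounded ℝ S) :
    IsVonNBounded ℝ (partialFourier '' S) := by
  rw [isVonNBounded_schwartz_iff]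
  intro j k
  obtain ⟨C, hC⟩ := norm_iteratedFDeriv_partialFourierFun_le k hS j
  refine ⟨C, ?_⟩
  rintro _ ⟨f, hf, rfl⟩ z
  exact hC f hf z

end PartialFourier

end Colombeau

end

noncomputable section

namespace Colombeau

open MeasureTheory Bornology Filter
open scoped FourierTransform

/-! ### Integration of slices against polynomially bounded weights -/

section WeightedIntegral

universe u

variable {X W : Type u} [NormedAddCommGroup X] [NormedSpace ℝ X]
  [NormedAddCommGroup W] [NormedSpace ℝ W] [MeasurableSpace W]
  [BorelSpace W] [SecondCountableTopology W] (μ : Measure W)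

/-- The integral of the slices of a function on a product against a weight. -/
def weightedIntegral {E : Type u} [NormedAddCommGroup E] [NormedSpace ℝ E] [NormedSpace ℂ E]
    (h : W → ℂ) (f : X × W → E) (x : X) : E := ∫ w, h w • f (x, w) ∂μ

variable (X W) in
/-- The partial derivative in the first variable, as an operator on Schwartz functions. -/
def derivFst (E : Type u) [NormedAddCommGroup E] [NormedSpace ℝ E] :
    𝓢(X × W, E) →L[ℝ] 𝓢(X × W, X →L[ℝ] E) :=
  (SchwartzMap.postcompCLM ((ContinuousLinearMap.compL ℝ X (X × W) E).flip
      (ContinuousLinearMap.inl ℝ X W))).comp (SchwartzMap.fderivCLM ℝ (X × W) E)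

theorem hasFDerivAt_derivFst {E : Type u} [NormedAddCommGroup E] [NormedSpace ℝ E]
    (f : 𝓢(X × W, E)) (x : X) (w : W) :
    HasFDerivAt (fun x => f (x, w)) (derivFst X W E f (x, w)) x := by
  have : HasFDerivAt (fun x : X => (x, w)) (ContinuousLinearMap.inl ℝ X W) x := by
    convert! (hasFDerivAt_id (𝕜 := ℝ) x).prodMk (hasFDerivAt_const w x) using 1
  exact (f.differentiableAt.hasFDerivAt (x := (x, w))).comp x this

/-- Measurable functions that are bounded by the polynomial `C * (1 + ‖w‖) ^ N`. -/
def polyBounded (C : ℝ) (N : ℕ) : Set (W → ℂ) :=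
  {h | AEStronglyMeasurable h μ ∧ ∀ w, ‖h w‖ ≤ C * (1 + ‖w‖) ^ N}

variable {μ} [μ.HasTemperateGrowth] {C : ℝ} {N : ℕ}

/-- The dominating function depends only on `S`, `C`, `N` and `j`, not on the weight `h`; this is
what makes the later estimates uniform in `ε`. -/
theorem norm_smul_slice_le {E : Type u} [NormedAddCommGroup E] [NormedSpace ℝ E]
    [NormedSpace ℂ E] {S : Set 𝓢(X × W, E)} (hS : IsVonNBounded ℝ S) (C : ℝ) (N j : ℕ) :
    ∃ B : W → ℝ, Integrable B μ ∧ ∀ f ∈ S, ∀ h ∈ polyBounded μ C N, ∀ x w,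
      ‖x‖ ^ j * ‖h w • f (x, w)‖ ≤ B w := by
  obtain ⟨B, hB, hBf⟩ := exists_integrable_bound_slices μ hS j N
  refine ⟨fun w => |C| * B w, hB.const_mul _, fun f hf h hh x w => ?_⟩
  rw [norm_smul]
  calc ‖x‖ ^ j * (‖h w‖ * ‖f (x, w)‖)
      ≤ ‖x‖ ^ j * (|C| * (1 + ‖w‖) ^ N * ‖f (x, w)‖) := by
        gcongr
        exact (hh.2 w).trans (by gcongr; exact le_abs_self C)
    _ = |C| * (‖x‖ ^ j * ((1 + ‖w‖) ^ N * ‖f (x, w)‖)) := by ring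
    _ ≤ |C| * B w := by gcongr; exact hBf f hf x w

theorem aestronglyMeasurable_smul_slice {E : Type u} [NormedAddCommGroup E] [NormedSpace ℝ E]
    [NormedSpace ℂ E] {h : W → ℂ} (hh : h ∈ polyBounded μ C N) (f : 𝓢(X × W, E)) (x : X) :
    AEStronglyMeasurable (fun w => h w • f (x, w)) μ :=
  hh.1.smul (f.continuous.comp (by fun_prop : Continuous fun w => (x, w))).aestronglyMeasurable

theorem integrable_smul_slice {E : Type u} [NormedAddCommGroup E] [NormedSpace ℝ E]
    [NormedSpace ℂ E] {h : W → ℂ} (hh : h ∈ polyBounded μ C N) (f : 𝓢(X × W, E)) (x : X) :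
    Integrable (fun w => h w • f (x, w)) μ := by
  obtain ⟨B, hB, hBf⟩ := norm_smul_slice_le (μ := μ) (isVonNBounded_singleton (𝕜 := ℝ) f) C N 0
  refine hB.mono' (aestronglyMeasurable_smul_slice hh f x) (Eventually.of_forall fun w => ?_)
  simpa using hBf f rfl h hh x w

/-- The weight does not involve `x`, so every derivative falls on the Schwartz function and no
regularity of `h` beyond measurability is needed. -/
theorem hasFDerivAt_weightedIntegral {E : Type u} [NormedAddCommGroup E] [NormedSpace ℝ E]
    [NormedSpace ℂ E] [IsScalarTower ℝ ℂ E] {h : W → ℂ} (hh : h ∈ polyBounded μ C N)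
    (f : 𝓢(X × W, E)) (x : X) :
    HasFDerivAt (weightedIntegral μ h f) (weightedIntegral μ h (derivFst X W E f) x) x := by
  obtain ⟨B, hB, hBf⟩ := norm_smul_slice_le (μ := μ)
    (isVonNBounded_singleton (𝕜 := ℝ) (derivFst X W E f)) C N 0
  refine hasFDerivAt_integral_of_dominated_of_fderiv_le univ_mem
    (Eventually.of_forall (aestronglyMeasurable_smul_slice hh f)) (integrable_smul_slice hh f x)
    (aestronglyMeasurable_smul_slice hh _ x) (bound := B) ?_ hB
    (Eventually.of_forall fun w x _ => (hasFDerivAt_derivFst f x w).const_smul (h w))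
  refine Eventually.of_forall fun w x _ => ?_
  simpa using hBf _ rfl h hh x w

theorem contDiff_nat_weightedIntegral {h : W → ℂ} (hh : h ∈ polyBounded μ C N) (m : ℕ) :
    ∀ {E : Type u} [NormedAddCommGroup E] [NormedSpace ℝ E] [NormedSpace ℂ E]
      [IsScalarTower ℝ ℂ E] (f : 𝓢(X × W, E)), ContDiff ℝ m (weightedIntegral μ h f) := by
  induction m with
  | zero =>
    intro E _ _ _ _ f
    rw [Nat.cast_zero, contDiff_zero]
    exact continuous_iff_continuousAt.2 fun x =>
      (hasFDerivAt_weightedIntegral hh f x).continuousAt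
  | succ m ih =>
    intro E _ _ _ _ f
    rw [Nat.cast_succ, contDiff_succ_iff_hasFDerivAt]
    exact ⟨_, ih (derivFst X W E f), hasFDerivAt_weightedIntegral hh f⟩

theorem contDiff_weightedIntegral {E : Type u} [NormedAddCommGroup E] [NormedSpace ℝ E]
    [NormedSpace ℂ E] [IsScalarTower ℝ ℂ E] {h : W → ℂ} (hh : h ∈ polyBounded μ C N)
    (f : 𝓢(X × W, E)) : ContDiff ℝ ∞ (weightedIntegral μ h f) :=
  contDiff_infty.2 fun m => contDiff_nat_weightedIntegral hh m f

/-- Integration of the slices against polynomially bounded weights maps bounded sets of Schwartz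
functions to uniformly rapidly decreasing functions. -/
theorem norm_iteratedFDeriv_weightedIntegral_le (C : ℝ) (N k : ℕ) :
    ∀ {E : Type u} [NormedAddCommGroup E] [NormedSpace ℝ E] [NormedSpace ℂ E]
      [IsScalarTower ℝ ℂ E] {S : Set 𝓢(X × W, E)},
      IsVonNBounded ℝ S → ∀ j : ℕ, ∃ D : ℝ, ∀ f ∈ S, ∀ h ∈ polyBounded μ C N, ∀ x,
        ‖x‖ ^ j * ‖iteratedFDeriv ℝ k (weightedIntegral μ h f) x‖ ≤ D := by
  induction k with
  | zero =>
    intro E _ _ _ _ S hS j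
    obtain ⟨B, hB, hBf⟩ := norm_smul_slice_le (μ := μ) hS C N j
    refine ⟨∫ w, B w ∂μ, fun f hf h hh x => ?_⟩
    rw [norm_iteratedFDeriv_zero]
    calc ‖x‖ ^ j * ‖weightedIntegral μ h f x‖
        ≤ ‖x‖ ^ j * ∫ w, ‖h w • f (x, w)‖ ∂μ := by
          gcongr; exact norm_integral_le_integral_norm _
      _ = ∫ w, ‖x‖ ^ j * ‖h w • f (x, w)‖ ∂μ := (integral_const_mul _ _).symm
      _ ≤ ∫ w, B w ∂μ :=
          integral_mono ((integrable_smul_slice hh f x).norm.const_mul _) hB (hBf f hf h hh x)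
  | succ k ih =>
    intro E _ _ _ _ S hS j
    obtain ⟨D, hD⟩ := ih (hS.image (derivFst X W E)) j
    refine ⟨D, fun f hf h hh x => ?_⟩
    have e : fderiv ℝ (weightedIntegral μ h f) = weightedIntegral μ h (derivFst X W E f) :=
      funext fun x => (hasFDerivAt_weightedIntegral hh f x).fderiv
    rw [← norm_iteratedFDeriv_fderiv, e]
    exact hD _ ⟨f, hf, rfl⟩ h hh x

end WeightedIntegral

/-! ### Regular nets as moderate nets of Schwartz functions -/

section RegularNets

variable {V V' : Type*} [NormedAddCommGroup V] [NormedSpace ℝ V] [NormedAddCommGroup V']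
  [NormedSpace ℝ V']

/-- A net of Schwartz functions is moderate if `ε ^ N` times it is bounded for some `N`. -/
def IsModerate (U : Eps → 𝓢(V, ℂ)) : Prop :=
  ∃ N : ℕ, IsVonNBounded ℝ (Set.range fun ε : Eps => ((ε : ℝ) ^ N) • U ε)

theorem norm_iteratedFDeriv_smul_schwartz (c : ℝ) (f : 𝓢(V, ℂ)) (k : ℕ) (x : V) :
    ‖iteratedFDeriv ℝ k (c • f) x‖ = |c| * ‖iteratedFDeriv ℝ k f x‖ := by
  have e : ⇑(c • f) = c • ⇑f := rfl
  rw [e, iteratedFDeriv_const_smul_apply (f.contDiffAt k), norm_smul, Real.norm_eq_abs]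

theorem IsModerate.isSRegularNet {U : Eps → 𝓢(V, ℂ)} (hU : IsModerate U) :
    IsSRegularNet fun ε => ⇑(U ε) := by
  obtain ⟨N, hN⟩ := hU
  refine ⟨fun ε => (U ε).smooth ⊤, N, fun j k => ?_⟩
  obtain ⟨C, hC⟩ := isVonNBounded_schwartz_iff.1 hN j k
  refine ⟨C, fun ε x => ?_⟩
  have := hC _ ⟨ε, rfl⟩ x
  rw [norm_iteratedFDeriv_smul_schwartz, abs_of_nonneg (pow_nonneg ε.2.1.le N)] at this
  exact (le_of_eq (by ring)).trans this

theorem IsSRegularNet.exists_isModerate {u : Eps → V → ℂ} (hu : IsSRegularNet u) :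
    ∃ U : Eps → 𝓢(V, ℂ), (∀ ε, ⇑(U ε) = u ε) ∧ IsModerate U := by
  obtain ⟨hs, N, hN⟩ := hu
  choose C hC using hN
  refine ⟨fun ε => ⟨u ε, hs ε, fun j k => ⟨C j k / (ε : ℝ) ^ N, fun x => ?_⟩⟩,
    fun ε => rfl, N, isVonNBounded_schwartz_iff.2 fun j k => ⟨C j k, ?_⟩⟩
  · rw [le_div_iff₀' (pow_pos ε.2.1 N)]
    exact hC j k ε x
  · rintro _ ⟨ε, rfl⟩ x
    rw [norm_iteratedFDeriv_smul_schwartz, abs_of_nonneg (pow_nonneg ε.2.1.le N)]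
    exact (mul_left_comm _ _ _).le.trans (hC j k ε x)

/-- Homogeneity pulls the factor `ε ^ N` through `T`, so the same exponent works for the image. -/
theorem IsModerate.map {U : Eps → 𝓢(V, ℂ)} (hU : IsModerate U) {T : 𝓢(V, ℂ) → 𝓢(V', ℂ)}
    (hT : ∀ (c : ℝ) f, T (c • f) = c • T f)
    (hTb : ∀ S, IsVonNBounded ℝ S → IsVonNBounded ℝ (T '' S)) :
    IsModerate fun ε => T (U ε) := by
  obtain ⟨N, hN⟩ := hU
  refine ⟨N, ?_⟩
  have := hTb _ hN
  rw [← Set.range_comp] at this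
  simpa only [Function.comp_def, hT] using this

theorem IsSRegularNet.tempered {u : Eps → V → ℂ} (hu : IsSRegularNet u) : u ∈ Tempered V := by
  obtain ⟨hs, N, hN⟩ := hu
  refine ⟨hs, fun k => ?_⟩
  obtain ⟨C, hC⟩ := hN 0 k
  refine ⟨N, |C|, fun ε x => ?_⟩
  have h1 := hC ε x
  rw [pow_zero, one_mul] at h1
  exact (h1.trans (le_abs_self C)).trans
    (le_mul_of_one_le_right (abs_nonneg C) (one_le_pow₀ (one_le_bracket x)))

end RegularNets

end Colombeau

end

noncomputable section

namespace Colombeau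

open MeasureTheory Bornology Filter
open scoped FourierTransform

/-! ### The correspondence between kernels and symbols -/

section KernelSymbol

variable {W : Type} [NormedAddCommGroup W] [InnerProductSpace ℝ W] [FiniteDimensional ℝ W]
  [MeasurableSpace W] [BorelSpace W]

variable (W) in
/-- The linear automorphism `(x, w) ↦ (x, c • w + d • x)`. -/
def shear (c d : ℝ) (hc : c ≠ 0) : (W × W) ≃L[ℝ] (W × W) :=
  ContinuousLinearEquiv.equivOfInverse
    ((ContinuousLinearMap.fst ℝ W W).prod
      (c • ContinuousLinearMap.snd ℝ W W + d • ContinuousLinearMap.fst ℝ W W))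
    ((ContinuousLinearMap.fst ℝ W W).prod
      (c⁻¹ • (ContinuousLinearMap.snd ℝ W W - d • ContinuousLinearMap.fst ℝ W W)))
    (fun z => by ext <;> simp [smul_smul, hc]) (fun z => by ext <;> simp [smul_smul, hc])

/-- The partial Fourier transform between two shears. -/
def shearFourier (c d : ℝ) (hc : c ≠ 0) (c' d' : ℝ) (hc' : c' ≠ 0) (f : 𝓢(W × W, ℂ)) :
    𝓢(W × W, ℂ) :=
  SchwartzMap.compCLMOfContinuousLinearEquiv ℝ (shear W c' d' hc') (partialFourier
    (SchwartzMap.compCLMOfContinuousLinearEquiv ℝ (shear W c d hc) f))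

theorem shearFourier_apply {c d : ℝ} (hc : c ≠ 0) {c' d' : ℝ} (hc' : c' ≠ 0)
    (f : 𝓢(W × W, ℂ)) (x w : W) :
    shearFourier c d hc c' d' hc' f (x, w) =
      ∫ v, (Real.fourierChar (-inner ℝ v (c' • w + d' • x)) : ℂ) * f (x, c • v + d • x) := rfl

theorem isModerate_shearFourier {c d : ℝ} (hc : c ≠ 0) {c' d' : ℝ} (hc' : c' ≠ 0)
    {U : Eps → 𝓢(W × W, ℂ)} (hU : IsModerate U) :
    IsModerate fun ε => shearFourier c d hc c' d' hc' (U ε) := by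
  refine hU.map (fun r f => ?_) fun S hS => ?_
  · rw [shearFourier, map_smul, partialFourier_smul, map_smul]
    rfl
  · have := (isVonNBounded_image_partialFourier (hS.image
      (SchwartzMap.compCLMOfContinuousLinearEquiv ℝ (shear W c d hc)))).image
      (SchwartzMap.compCLMOfContinuousLinearEquiv ℝ (shear W c' d' hc'))
    rwa [Set.image_image, Set.image_image] at this

/-- The kernel `(2π)^(-n) ∫ e^(i(x-y)·ξ) a(x,ξ) dξ` of the operator with symbol `a`. -/
def kernelOfSymbol : 𝓢(W × W, ℂ) → 𝓢(W × W, ℂ) :=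
  shearFourier (2 * Real.pi) 0 Real.two_pi_pos.ne' 1 (-1) one_ne_zero

/-- The symbol `∫ e^(-iw·ξ) k(x,x-w) dw` of the operator with kernel `k`. -/
def symbolOfKernel : 𝓢(W × W, ℂ) → 𝓢(W × W, ℂ) :=
  shearFourier (-1) 1 (by norm_num) (2 * Real.pi)⁻¹ 0 (inv_ne_zero Real.two_pi_pos.ne')

theorem fourierChar_eq_cexp (t : ℝ) :
    (Real.fourierChar t : ℂ) = Complex.exp (Complex.I * ((2 * Real.pi * t : ℝ) : ℂ)) := by
  rw [Real.fourierChar_apply, mul_comm Complex.I]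

/-- The substitution `ξ = 2πv` passes from the character `e^(2πit)` to the phase `e^(it)`; its
Jacobian is the factor `(2π)^(-n)`. -/
theorem kernelOfSymbol_apply (a : 𝓢(W × W, ℂ)) (x y : W) :
    kernelOfSymbol a (x, y) = (((2 * Real.pi) ^ Module.finrank ℝ W)⁻¹ : ℝ) *
      ∫ ξ, Complex.exp (Complex.I * (inner ℝ (x - y) ξ : ℝ)) * a (x, ξ) := by
  have h := Measure.integral_comp_smul (volume : Measure W)
    (fun ξ => Complex.exp (Complex.I * (inner ℝ (x - y) ξ : ℝ)) * a (x, ξ)) (2 * Real.pi)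
  rw [abs_of_nonneg (by positivity), Complex.real_smul] at h
  rw [← h, kernelOfSymbol, shearFourier_apply]
  refine integral_congr_ae (Eventually.of_forall fun v => ?_)
  have e : 2 * Real.pi * -inner ℝ v ((1 : ℝ) • y + (-1 : ℝ) • x) =
      inner ℝ (x - y) ((2 * Real.pi) • v) := by
    rw [real_inner_smul_right, real_inner_comm, one_smul, neg_one_smul, inner_add_left,
      inner_neg_left, inner_sub_left]
    ring
  beta_reduce
  rw [fourierChar_eq_cexp, e, zero_smul, add_zero]

/-- Fourier inversion in the second variable for `g(x,w) = k(x,x-w)`: the dilations by `2π` and its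
inverse cancel, and the Fourier transform applied twice and evaluated at `-(x-y)` returns `g(x,x-y)
= k(x,y)`. -/
theorem kernelOfSymbol_symbolOfKernel (k : 𝓢(W × W, ℂ)) :
    kernelOfSymbol (symbolOfKernel k) = k := by
  set g := SchwartzMap.compCLMOfContinuousLinearEquiv ℝ (shear W (-1) 1 (by norm_num)) k with hg
  have e : SchwartzMap.compCLMOfContinuousLinearEquiv ℝ (shear W (2 * Real.pi) 0
      Real.two_pi_pos.ne') (symbolOfKernel k) = partialFourier g := by
    ext ⟨x, ξ⟩
    have : (2 * Real.pi)⁻¹ • ((2 * Real.pi) • ξ + (0 : ℝ) • x) + (0 : ℝ) • x = ξ := by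
      rw [zero_smul, add_zero, add_zero, inv_smul_smul₀ Real.two_pi_pos.ne']
    change partialFourier g (x, (2 * Real.pi)⁻¹ • ((2 * Real.pi) • ξ + (0 : ℝ) • x) + (0 : ℝ) • x)
      = _
    rw [this]
  ext ⟨x, y⟩
  rw [kernelOfSymbol, shearFourier, e]
  change partialFourier (partialFourier g) (x, (1 : ℝ) • y + (-1 : ℝ) • x) = _
  have e2 : (1 : ℝ) • y + (-1 : ℝ) • x = -(x - y) := by simp; abel
  rw [partialFourier_apply, slice_partialFourier, e2]
  have e3 : 𝓕 (𝓕 (slice x g)) (-(x - y)) = 𝓕⁻ (𝓕 (slice x g)) (x - y) := by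
    rw [SchwartzMap.fourierInv_coe, Real.fourierInv_eq_fourier_neg, SchwartzMap.fourier_coe]
  rw [e3, FourierTransform.fourierInv_fourier_eq]
  change k (x, (-1 : ℝ) • (x - y) + (1 : ℝ) • x) = _
  congr 2
  simp

end KernelSymbol

/-! ### Smoothing symbols and weight functions -/

section Symbols

variable {n : ℕ}

theorem one_le_euclBracket (z : Rn n × Rn n) : 1 ≤ euclBracket z := by
  rw [euclBracket, Real.one_le_sqrt]
  nlinarith [sq_nonneg (euclNorm z)]

theorem norm_le_euclBracket (z : Rn n × Rn n) : ‖z‖ ≤ euclBracket z := by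
  refine Real.le_sqrt_of_sq_le ?_
  rw [euclNorm, Real.sq_sqrt (by positivity)]
  rcases max_choice ‖z.1‖ ‖z.2‖ with h | h <;> rw [Prod.norm_def, h] <;>
    nlinarith [sq_nonneg ‖z.1‖, sq_nonneg ‖z.2‖]

theorem euclBracket_le (z : Rn n × Rn n) : euclBracket z ≤ 2 * (1 + ‖z‖) := by
  rw [euclBracket, euclNorm, Real.sq_sqrt (by positivity)]
  refine Real.sqrt_le_iff.2 ⟨by positivity, ?_⟩
  have h1 : ‖z.1‖ ^ 2 ≤ ‖z‖ ^ 2 := by gcongr; exact norm_fst_le z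
  have h2 : ‖z.2‖ ^ 2 ≤ ‖z‖ ^ 2 := by gcongr; exact norm_snd_le z
  nlinarith [norm_nonneg z]

/-- Negative powers of a weight function decay rapidly. -/
theorem IsWeight.exists_norm_pow_mul_rpow_le {Λ : Rn n × Rn n → ℝ} (hΛ : IsWeight Λ) (j : ℕ) :
    ∃ m C : ℝ, 0 ≤ C ∧ ∀ z, ‖z‖ ^ j * Λ z ^ m ≤ C := by
  obtain ⟨-, ⟨μ, hμ, ⟨c, hc, h⟩, -⟩, -⟩ := hΛ
  -- The lower bound on `Λ`, raised to the power `j / μ`, reads `⟨z⟩ ^ j ≤ (c Λ) ^ (j / μ)`.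
  refine ⟨-(j / μ), c ^ ((j : ℝ) / μ), by positivity, fun z => ?_⟩
  have hb : 0 < euclBracket z := zero_lt_one.trans_le (one_le_euclBracket z)
  have hΛ : 0 < Λ z := by
    have := (Real.rpow_pos_of_pos hb μ).trans_le (h z)
    exact (mul_pos_iff_of_pos_left hc).1 this
  rw [Real.rpow_neg hΛ.le, ← div_eq_mul_inv, div_le_iff₀ (by positivity),
    ← Real.mul_rpow hc.le hΛ.le]
  calc ‖z‖ ^ j ≤ euclBracket z ^ j := by gcongr; exact norm_le_euclBracket z
    _ = (euclBracket z ^ μ) ^ ((j : ℝ) / μ) := by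
      rw [← Real.rpow_mul hb.le, mul_div_cancel₀ _ hμ.ne', Real.rpow_natCast]
    _ ≤ (c * Λ z) ^ ((j : ℝ) / μ) := by
      gcongr
      exact h z

/-- Every power of a weight function is at least a negative power of the norm. -/
theorem IsWeight.exists_one_le_mul_rpow {Λ : Rn n × Rn n → ℝ} (hΛ : IsWeight Λ) (s : ℝ) :
    ∃ (j : ℕ) (C : ℝ), 0 < C ∧ ∀ z, 1 ≤ C * (1 + ‖z‖) ^ j * Λ z ^ s := by
  obtain ⟨-, ⟨μ, hμ, ⟨c, hc, h⟩, ⟨d, hd, h'⟩, -⟩, -⟩ := hΛ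
  have hb : ∀ z : Rn n × Rn n, 0 < euclBracket z := fun z =>
    zero_lt_one.trans_le (one_le_euclBracket z)
  have hΛ1 : ∀ z, 1 ≤ c * Λ z := fun z =>
    (Real.one_le_rpow (one_le_euclBracket z) hμ.le).trans (h z)
  have hΛ : ∀ z, 0 < Λ z := fun z =>
    (mul_pos_iff_of_pos_left hc).1 (zero_lt_one.trans_le (hΛ1 z))
  -- For `s ≥ 0` it is enough that `Λ` is bounded below; for `s ≤ 0` the linear upper bound on `Λ`
  -- gives at most polynomial growth of `Λ ^ (-s)`.
  rcases le_total 0 s with hs | hs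
  · refine ⟨0, c ^ s, by positivity, fun z => ?_⟩
    rw [pow_zero, mul_one, ← Real.mul_rpow hc.le (hΛ z).le]
    exact Real.one_le_rpow (hΛ1 z) hs
  · obtain ⟨j, hj⟩ := exists_nat_ge (-s)
    refine ⟨j, (d * 2) ^ (-s), by positivity, fun z => ?_⟩
    have h1 : Λ z ^ (-s) ≤ (d * 2) ^ (-s) * (1 + ‖z‖) ^ j := by
      calc Λ z ^ (-s) ≤ (d * 2 * (1 + ‖z‖)) ^ (-s) := by
            refine Real.rpow_le_rpow (hΛ z).le ?_ (by linarith)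
            rw [mul_assoc]
            exact (h' z).trans (by gcongr; exact euclBracket_le z)
        _ = (d * 2) ^ (-s) * (1 + ‖z‖) ^ (-s) := Real.mul_rpow (by positivity) (by positivity)
        _ ≤ (d * 2) ^ (-s) * (1 + ‖z‖) ^ j := by
            rw [← Real.rpow_natCast]
            gcongr
            linarith [norm_nonneg z]
    calc 1 = Λ z ^ (-s) * Λ z ^ s := by rw [← Real.rpow_add (hΛ z), neg_add_cancel, Real.rpow_zero]
      _ ≤ _ := by
        gcongr
        exact (Real.rpow_pos_of_pos (hΛ z) s).le

/-- For every weight function, the smoothing symbols are the nets of rapidly decreasing functions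
that are moderate with one exponent for all derivatives. -/
theorem mem_smoothingSymbols_iff {Λ : Rn n × Rn n → ℝ} (hΛ : IsWeight Λ) (ρ : ℝ)
    (a : Eps → Rn n × Rn n → ℂ) : a ∈ SmoothingSymbols Λ ρ ↔ IsSRegularNet a := by
  simp only [SmoothingSymbols, Set.mem_iUnion, Set.mem_iInter]
  constructor
  · rintro ⟨N, h⟩
    refine ⟨(h 0).1, N, fun j k => ?_⟩
    obtain ⟨m, C, hC, hm⟩ := hΛ.exists_norm_pow_mul_rpow_le j
    -- The order `m + ρk` cancels the gain of `ρk` from `k` derivatives. It may depend on `j` and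
    -- `k` because `N` is common to all orders.
    obtain ⟨c, hc, h2⟩ := (h (m + ρ * k)).2 k
    refine ⟨c * C, fun ε z => ?_⟩
    have hε : (0 : ℝ) < (ε : ℝ) ^ N := pow_pos ε.2.1 N
    have h3 := h2 ε z
    rw [add_sub_cancel_right] at h3
    calc (ε : ℝ) ^ N * (‖z‖ ^ j * ‖iteratedFDeriv ℝ k (a ε) z‖)
        ≤ (ε : ℝ) ^ N * (‖z‖ ^ j * (c * Λ z ^ m * ((ε : ℝ) ^ N)⁻¹)) := by gcongr
      _ = c * (‖z‖ ^ j * Λ z ^ m) := by field_simp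
      _ ≤ c * C := by gcongr; exact hm z
  · intro ha
    obtain ⟨U, hU, N, hN⟩ := ha.exists_isModerate
    refine ⟨N, fun m => ⟨ha.1, fun k => ?_⟩⟩
    obtain ⟨j, C, hC, h1⟩ := hΛ.exists_one_le_mul_rpow (m - ρ * k)
    obtain ⟨r, hr, hr2⟩ := (schwartz_withSeminorms ℝ (Rn n × Rn n)
      ℂ).isVonNBounded_iff_finset_seminorm_bounded.1 hN (Finset.Iic (j, k))
    refine ⟨2 ^ j * r * C, by positivity, fun ε z => ?_⟩
    have hε : (0 : ℝ) < (ε : ℝ) ^ N := pow_pos ε.2.1 N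
    have h2 := SchwartzMap.one_add_le_sup_seminorm_apply (𝕜 := ℝ) (m := (j, k)) le_rfl le_rfl
      (((ε : ℝ) ^ N) • U ε) z
    have h3 := h2.trans (mul_le_mul_of_nonneg_left (hr2 _ ⟨ε, rfl⟩).le (by positivity))
    rw [norm_iteratedFDeriv_smul_schwartz, abs_of_pos hε, hU] at h3
    have hp : 0 < Λ z ^ (m - ρ * k) := by
      by_contra hneg
      have := mul_nonpos_of_nonneg_of_nonpos (by positivity : 0 ≤ C * (1 + ‖z‖) ^ j)
        (not_lt.1 hneg)
      linarith [h1 z]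
    rw [← div_eq_mul_inv, le_div_iff₀' hε]
    calc (ε : ℝ) ^ N * ‖iteratedFDeriv ℝ k (a ε) z‖
        ≤ (ε : ℝ) ^ N * ‖iteratedFDeriv ℝ k (a ε) z‖ *
            (C * (1 + ‖z‖) ^ j * Λ z ^ (m - ρ * k)) :=
          le_mul_of_one_le_right (by positivity) (h1 z)
      _ = ((1 + ‖z‖) ^ j * ((ε : ℝ) ^ N * ‖iteratedFDeriv ℝ k (a ε) z‖)) *
            (C * Λ z ^ (m - ρ * k)) := by ring
      _ ≤ (2 ^ j * r) * (C * Λ z ^ (m - ρ * k)) := by gcongr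
      _ = _ := by ring

end Symbols

end Colombeau

end

noncomputable section

namespace Colombeau

open MeasureTheory Bornology Filter
open scoped FourierTransform

variable {n : ℕ}

/-! ### The weights `u_ε (φ_ε)^` -/

section Weights

theorem bracket_le_one_add_norm {V : Type*} [NormedAddCommGroup V] (x : V) :
    bracket x ≤ 1 + ‖x‖ := by
  refine Real.sqrt_le_iff.2 ⟨by positivity, ?_⟩
  nlinarith [norm_nonneg x]

theorem exists_schwartz_scaled (φ : 𝓢(Rn n, ℂ)) (ε : Eps) :
    ∃ g : 𝓢(Rn n, ℂ), ⇑g = scaled φ ε := by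
  refine ⟨(((ε : ℝ) ^ n)⁻¹ : ℝ) • SchwartzMap.compCLMOfContinuousLinearEquiv ℝ
    (ContinuousLinearEquiv.smulLeft (Units.mk0 ((ε : ℝ)⁻¹) (inv_ne_zero ε.2.1.ne'))) φ, ?_⟩
  ext x
  rw [smul_apply, Complex.real_smul]
  rfl

theorem scaledHat_eq_fourier (φ : 𝓢(Rn n, ℂ)) (ε : Eps) (y : Rn n) :
    scaledHat φ ε y = 𝓕 (scaled φ ε) ((2 * Real.pi)⁻¹ • y) := by
  rw [Real.fourier_eq, scaledHat]
  refine integral_congr_ae (Eventually.of_forall fun x => ?_)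
  beta_reduce
  rw [Circle.smul_def, fourierChar_eq_cexp, real_inner_smul_right, smul_eq_mul]
  congr 2
  have : 2 * Real.pi * -((2 * Real.pi)⁻¹ * inner ℝ x y) = -inner ℝ x y := by
    field_simp
  rw [this]
  push_cast
  ring

theorem exists_schwartz_scaledHat (φ : 𝓢(Rn n, ℂ)) (ε : Eps) :
    ∃ g : 𝓢(Rn n, ℂ), ⇑g = scaledHat φ ε := by
  obtain ⟨g, hg⟩ := exists_schwartz_scaled φ ε
  refine ⟨SchwartzMap.compCLMOfContinuousLinearEquiv ℝ (ContinuousLinearEquiv.smulLeft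
    (Units.mk0 ((2 * Real.pi)⁻¹) (inv_ne_zero Real.two_pi_pos.ne'))) (𝓕 g), ?_⟩
  ext y
  rw [scaledHat_eq_fourier, ← hg]
  rfl

/-- The scaling preserves the L¹ norm, so the bound does not depend on `ε`. -/
theorem norm_scaledHat_le (φ : 𝓢(Rn n, ℂ)) (ε : Eps) (y : Rn n) :
    ‖scaledHat φ ε y‖ ≤ ∫ x, ‖φ x‖ := by
  refine (norm_integral_le_integral_norm _).trans (le_of_eq ?_)
  have h := Measure.integral_comp_inv_smul (volume : Measure (Rn n)) (fun x => ‖φ x‖) (ε : ℝ)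
  have hε : (0 : ℝ) < (ε : ℝ) ^ n := pow_pos ε.2.1 n
  rw [finrank_euclideanSpace, Fintype.card_fin, abs_of_pos hε, smul_eq_mul] at h
  have e : ∀ x : Rn n, ‖Complex.exp (-Complex.I * (inner ℝ x y : ℝ)) * scaled φ ε x‖ =
      ((ε : ℝ) ^ n)⁻¹ * ‖φ ((ε : ℝ)⁻¹ • x)‖ := by
    intro x
    have : -Complex.I * (inner ℝ x y : ℝ) = ((-inner ℝ x y : ℝ) : ℂ) * Complex.I := by
      push_cast; ring
    rw [norm_mul, this, Complex.norm_exp_ofReal_mul_I, one_mul, scaled, norm_mul,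
      Complex.norm_of_nonneg (inv_nonneg.2 hε.le)]
  simp_rw [e]
  rw [integral_const_mul, h, inv_mul_cancel_left₀ hε.ne']

theorem exists_pow_mul_norm_le {V : Type*} [NormedAddCommGroup V] [NormedSpace ℝ V]
    {u : Eps → V → ℂ} (hu : u ∈ Tempered V) : ∃ (N : ℕ) (C : ℝ), ∀ (ε : Eps) (x : V),
      (ε : ℝ) ^ N * ‖u ε x‖ ≤ C * (1 + ‖x‖) ^ N := by
  obtain ⟨N, C, h⟩ := hu.2 0
  refine ⟨N, |C|, fun ε x => ?_⟩
  have := h ε x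
  rw [norm_iteratedFDeriv_zero] at this
  have hb : 0 ≤ bracket x := zero_le_one.trans (one_le_bracket x)
  exact this.trans (by
    gcongr
    · exact le_abs_self C
    · exact bracket_le_one_add_norm x)

theorem aestronglyMeasurable_mul_scaledHat (φ : 𝓢(Rn n, ℂ)) {u : Eps → Rn n → ℂ}
    (hu : u ∈ Tempered (Rn n)) (ε : Eps) :
    AEStronglyMeasurable (fun y => u ε y * scaledHat φ ε y) volume := by
  obtain ⟨g, hg⟩ := exists_schwartz_scaledHat φ ε
  rw [← hg]
  have : ContDiff ℝ ∞ (u ε) := hu.1 ε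
  exact (this.continuous.mul g.continuous).aestronglyMeasurable

/-- For fixed `ε` the Schwartz decay of `(φ_ε)^` beats the polynomial growth of `u_ε`. No uniformity
in `ε` is claimed; uniform estimates use only the sup bound on `(φ_ε)^`. -/
theorem integrable_mul_scaledHat (φ : 𝓢(Rn n, ℂ)) {u : Eps → Rn n → ℂ}
    (hu : u ∈ Tempered (Rn n)) (ε : Eps) :
    Integrable (fun y => u ε y * scaledHat φ ε y) := by
  obtain ⟨N, C, h⟩ := exists_pow_mul_norm_le hu
  obtain ⟨g, hg⟩ := exists_schwartz_scaledHat φ ε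
  have hε : (0 : ℝ) < (ε : ℝ) ^ N := pow_pos ε.2.1 N
  have hi : Integrable (fun y : Rn n =>
      ((ε : ℝ) ^ N)⁻¹ * |C| * (2 ^ N * (‖g y‖ + ‖y‖ ^ N * ‖g y‖))) :=
    ((g.integrable.norm.add (g.integrable_pow_mul volume N)).const_mul _).const_mul _
  refine hi.mono' (aestronglyMeasurable_mul_scaledHat φ hu ε) (Eventually.of_forall fun y => ?_)
  rw [← hg, norm_mul]
  have h1 : ‖u ε y‖ ≤ ((ε : ℝ) ^ N)⁻¹ * (|C| * (1 + ‖y‖) ^ N) := by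
    rw [← div_eq_inv_mul, le_div_iff₀' hε]
    exact (h ε y).trans (by gcongr; exact le_abs_self C)
  have h2 : (1 + ‖y‖) ^ N ≤ 2 ^ N * (1 + ‖y‖ ^ N) := by
    rcases le_total 1 ‖y‖ with hy | hy
    · calc (1 + ‖y‖) ^ N ≤ (2 * ‖y‖) ^ N := by gcongr; linarith
        _ = 2 ^ N * ‖y‖ ^ N := mul_pow _ _ _
        _ ≤ _ := by gcongr; linarith
    · calc (1 + ‖y‖) ^ N ≤ 2 ^ N := by gcongr; linarith
        _ ≤ _ := le_mul_of_one_le_right (by positivity) (by linarith [pow_nonneg (norm_nonneg y) N])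
  calc ‖u ε y‖ * ‖g y‖ ≤ ((ε : ℝ) ^ N)⁻¹ * (|C| * (2 ^ N * (1 + ‖y‖ ^ N))) * ‖g y‖ := by
        gcongr
        exact h1.trans (by gcongr)
    _ = _ := by ring

/-- The weights `u_ε (φ_ε)^` grow at most polynomially, uniformly up to a power of `ε`. -/
theorem exists_smul_mem_polyBounded (φ : 𝓢(Rn n, ℂ)) {u : Eps → Rn n → ℂ}
    (hu : u ∈ Tempered (Rn n)) : ∃ (N : ℕ) (C : ℝ), ∀ ε : Eps,
      (fun y => (((ε : ℝ) ^ N : ℝ) : ℂ) * (u ε y * scaledHat φ ε y)) ∈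
        polyBounded (volume : Measure (Rn n)) C N := by
  obtain ⟨N, C, h⟩ := exists_pow_mul_norm_le hu
  refine ⟨N, C * ∫ x, ‖φ x‖, fun ε => ⟨?_, fun y => ?_⟩⟩
  · exact (aestronglyMeasurable_mul_scaledHat φ hu ε).const_mul _
  · rw [norm_mul, norm_mul, Complex.norm_of_nonneg (pow_nonneg ε.2.1.le N), ← mul_assoc]
    calc (ε : ℝ) ^ N * ‖u ε y‖ * ‖scaledHat φ ε y‖
        ≤ (C * (1 + ‖y‖) ^ N) * ∫ x, ‖φ x‖ := by
          refine mul_le_mul (h ε y) (norm_scaledHat_le φ ε y) (norm_nonneg _) ?_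
          exact (mul_nonneg (pow_nonneg ε.2.1.le N) (norm_nonneg _)).trans (h ε y)
      _ = _ := by ring

end Weights

/-! ### Independence of the representative of the kernel -/

section NegligibleKernels

theorem exists_schwartz_of_mem_negligible {V : Type*} [NormedAddCommGroup V] [NormedSpace ℝ V]
    {u : Eps → V → ℂ} (hu : u ∈ Negligible V) : ∃ U : Eps → 𝓢(V, ℂ), (∀ ε, ⇑(U ε) = u ε) ∧
      ∀ q : ℕ, IsVonNBounded ℝ (Set.range fun ε : Eps => (((ε : ℝ) ^ q)⁻¹) • U ε) := by
  obtain ⟨hs, h⟩ := hu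
  choose C hC using h
  refine ⟨fun ε => ⟨u ε, hs ε, fun j k => ⟨C j k 0 * (ε : ℝ) ^ 0, hC j k 0 ε⟩⟩, fun ε => rfl,
    fun q => isVonNBounded_schwartz_iff.2 fun j k => ⟨C j k q, ?_⟩⟩
  rintro _ ⟨ε, rfl⟩ x
  have hε : (0 : ℝ) < (ε : ℝ) ^ q := pow_pos ε.2.1 q
  rw [norm_iteratedFDeriv_smul_schwartz, abs_of_pos (inv_pos.2 hε), mul_left_comm,
    ← div_eq_inv_mul, div_le_iff₀ hε]
  exact hC j k q ε x

/-- Negligible kernels act by negligible nets. -/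
theorem integral_mem_negligible (φ : 𝓢(Rn n, ℂ)) {k : Eps → Rn n × Rn n → ℂ}
    (hk : k ∈ Negligible (Rn n × Rn n)) {u : Eps → Rn n → ℂ} (hu : u ∈ Tempered (Rn n)) :
    (fun ε x => ∫ y, k ε (x, y) * (u ε y * scaledHat φ ε y)) ∈ Negligible (Rn n) := by
  obtain ⟨U, hU, hb⟩ := exists_schwartz_of_mem_negligible hk
  obtain ⟨N, C, hh⟩ := exists_smul_mem_polyBounded φ hu
  -- The kernel is divided by `ε ^ (q + N)`, which keeps it in a bounded set; `N` of these powers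
  -- make the weight uniformly polynomially bounded and the other `q` remain in front.
  have key : ∀ (q : ℕ) (ε : Eps), (fun x => ∫ y, k ε (x, y) * (u ε y * scaledHat φ ε y)) =
      ((ε : ℝ) ^ q) • weightedIntegral volume
        (fun y => (((ε : ℝ) ^ N : ℝ) : ℂ) * (u ε y * scaledHat φ ε y))
        ((((ε : ℝ) ^ (q + N))⁻¹) • U ε) := by
    intro q ε
    have hε : (ε : ℂ) ≠ 0 := Complex.ofReal_ne_zero.2 ε.2.1.ne'
    ext x
    rw [Pi.smul_apply, weightedIntegral, ← integral_smul]
    refine integral_congr_ae (Eventually.of_forall fun y => ?_)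
    beta_reduce
    rw [smul_apply, hU, Complex.real_smul, Complex.real_smul, smul_eq_mul]
    push_cast
    field_simp
    ring
  refine ⟨fun ε => ?_, fun j l q => ?_⟩
  · beta_reduce
    rw [key 0 ε]
    exact ContDiff.const_smul ((ε : ℝ) ^ 0)
      (contDiff_weightedIntegral (hh ε) ((((ε : ℝ) ^ (0 + N))⁻¹) • U ε))
  · obtain ⟨D, hD⟩ := norm_iteratedFDeriv_weightedIntegral_le (μ := (volume : Measure (Rn n)))
      C N l (E := ℂ) (hb (q + N)) j
    refine ⟨D, fun ε x => ?_⟩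
    have hc := (contDiff_weightedIntegral (hh ε) ((((ε : ℝ) ^ (q + N))⁻¹) • U ε)).of_le
      (mod_cast le_top : (l : WithTop ℕ∞) ≤ ∞)
    beta_reduce
    rw [key q ε, iteratedFDeriv_const_smul_apply hc.contDiffAt, norm_smul,
      Real.norm_of_nonneg (pow_nonneg ε.2.1.le q), mul_left_comm, mul_comm]
    gcongr
    · exact pow_nonneg ε.2.1.le q
    · exact hD _ ⟨ε, rfl⟩ _ (hh ε) x

end NegligibleKernels

/-! ### Oscillatory integrals with Schwartz symbol -/

section OscillatoryIntegrals

theorem exists_schwartz_apply_zero_eq_one (V : Type*) [NormedAddCommGroup V] [NormedSpace ℝ V]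
    [FiniteDimensional ℝ V] : ∃ ψ : 𝓢(V, ℂ), ψ 0 = 1 := by
  let b : ContDiffBump (0 : V) := ⟨1, 2, one_pos, one_lt_two⟩
  have h1 : HasCompactSupport fun x => (b x : ℂ) :=
    b.hasCompactSupport.comp_left Complex.ofReal_zero
  have h2 : ContDiff ℝ ∞ fun x => (b x : ℂ) := Complex.ofRealCLM.contDiff.comp b.contDiff
  refine ⟨h1.toSchwartzMap h2, ?_⟩
  change (b 0 : ℂ) = 1
  rw [b.one_of_mem_closedBall (Metric.mem_closedBall_self zero_le_one), Complex.ofReal_one]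

theorem IsOscIntegral.unique {θ : Rn n × Rn n → ℝ} {b : Rn n × Rn n → ℂ} {I J : ℂ}
    (hI : IsOscIntegral θ b I) (hJ : IsOscIntegral θ b J) : I = J := by
  obtain ⟨ψ, hψ⟩ := exists_schwartz_apply_zero_eq_one (Rn n × Rn n)
  exact tendsto_nhds_unique (hI ψ hψ).2 (hJ ψ hψ).2

/-- An absolutely convergent integral is an oscillatory integral. -/
theorem isOscIntegral_of_integrable {θ : Rn n × Rn n → ℝ} {b : Rn n × Rn n → ℂ}
    (h : Integrable fun z => Complex.exp (Complex.I * θ z) * b z) :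
    IsOscIntegral θ b (∫ z, Complex.exp (Complex.I * θ z) * b z) := by
  intro ψ hψ
  have hbd : ∀ z, ‖ψ z‖ ≤ SchwartzMap.seminorm ℝ 0 0 ψ := ψ.norm_le_seminorm ℝ
  have hcont : ∀ t : ℝ, Continuous fun z => ψ (t • z) := fun t =>
    ψ.continuous.comp (continuous_const_smul t)
  have hint : ∀ t : ℝ, Integrable fun z => Complex.exp (Complex.I * θ z) * b z * ψ (t • z) :=
    fun t => h.mul_bdd (hcont t).aestronglyMeasurable (Eventually.of_forall fun z => hbd _)
  refine ⟨fun t _ => hint t, ?_⟩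
  -- The cut-off is bounded by its sup norm and tends pointwise to `ψ 0 = 1`.
  refine tendsto_integral_filter_of_dominated_convergence
    (fun z => ‖Complex.exp (Complex.I * θ z) * b z‖ * SchwartzMap.seminorm ℝ 0 0 ψ)
    (Eventually.of_forall fun t => (hint t).aestronglyMeasurable)
    (Eventually.of_forall fun t => Eventually.of_forall fun z => ?_) (h.norm.mul_const _)
    (Eventually.of_forall fun z => ?_)
  · rw [norm_mul]
    gcongr
    exact hbd _
  · have h1 : Tendsto (fun t : ℝ => ψ (t • z)) (𝓝[>] 0) (𝓝 (ψ ((0 : ℝ) • z))) :=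
      ((ψ.continuous.comp (by fun_prop : Continuous fun t : ℝ => t • z)).tendsto 0).mono_left
        nhdsWithin_le_nhds
    rw [zero_smul, hψ] at h1
    simpa using h1.const_mul (Complex.exp (Complex.I * θ z) * b z)

/-- A pseudo-differential operator with Schwartz symbol is the integral operator with the
corresponding kernel. -/
theorem isOscIntegral_kernelOfSymbol (a : 𝓢(Rn n × Rn n, ℂ)) {u g : Rn n → ℂ}
    (h : Integrable fun y => u y * g y) (x : Rn n) :
    IsOscIntegral (fun z => -inner ℝ z.1 z.2)
      (fun z => (((2 * Real.pi) ^ n)⁻¹ : ℝ) * (Complex.exp (Complex.I * (inner ℝ x z.2 : ℝ)) *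
        a (x, z.2) * u z.1 * g z.1))
      (∫ y, kernelOfSymbol a (x, y) * (u y * g y)) := by
  set c : ℂ := ((((2 * Real.pi) ^ n)⁻¹ : ℝ) : ℂ) with hc
  have e : ∀ z : Rn n × Rn n, Complex.exp (Complex.I * ((-inner ℝ z.1 z.2 : ℝ) : ℂ)) *
      (c * (Complex.exp (Complex.I * (inner ℝ x z.2 : ℝ)) * a (x, z.2) * u z.1 * g z.1)) =
      c * Complex.exp (Complex.I * (inner ℝ (x - z.1) z.2 : ℝ)) *
        (u z.1 * g z.1 * slice x a z.2) := by
    intro z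
    have : Complex.I * (inner ℝ (x - z.1) z.2 : ℝ) =
        Complex.I * ((-inner ℝ z.1 z.2 : ℝ) : ℂ) + Complex.I * (inner ℝ x z.2 : ℝ) := by
      rw [inner_sub_left]; push_cast; ring
    rw [this, Complex.exp_add, slice_apply]
    ring
  have hint : Integrable fun z : Rn n × Rn n =>
      c * Complex.exp (Complex.I * (inner ℝ (x - z.1) z.2 : ℝ)) *
        (u z.1 * g z.1 * slice x a z.2) := by
    -- Apart from a unimodular factor and a constant, the integrand is a product of an integrable
    -- function of `y` and a Schwartz function of `ξ`.
    refine (h.mul_prod (slice x a).integrable).bdd_mul (c := ‖c‖) ?_ ?_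
    · exact (by fun_prop : Continuous fun z : Rn n × Rn n =>
        c * Complex.exp (Complex.I * (inner ℝ (x - z.1) z.2 : ℝ))).aestronglyMeasurable
    · refine Eventually.of_forall fun z => ?_
      rw [norm_mul, mul_comm Complex.I, Complex.norm_exp_ofReal_mul_I, mul_one]
  have key := isOscIntegral_of_integrable (θ := fun z : Rn n × Rn n => -inner ℝ z.1 z.2)
    (b := fun z => c * (Complex.exp (Complex.I * (inner ℝ x z.2 : ℝ)) *
        a (x, z.2) * u z.1 * g z.1)) (by simpa only [e] using hint)
  convert key using 1
  simp_rw [e]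
  rw [Measure.volume_eq_prod, integral_prod _ hint]
  refine integral_congr_ae (Eventually.of_forall fun y => ?_)
  beta_reduce
  rw [kernelOfSymbol_apply, finrank_euclideanSpace, Fintype.card_fin, ← hc, mul_assoc,
    ← integral_mul_const, ← integral_const_mul]
  refine integral_congr_ae (Eventually.of_forall fun ξ => ?_)
  simp only [slice_apply]
  ring

end OscillatoryIntegrals

end Colombeau

end

/-! ### The two implications -/

open Colombeau in
-- With the symbol taken from a regular representative of the kernel, the two operators agree on
-- nets, so no correction modulo negligible nets is needed.
theorem Colombeau.HasSRegularKernel.exists_isPseudoDiffOp {n : ℕ} {φ : 𝓢(Rn n, ℂ)}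
    {Λ : Rn n × Rn n → ℝ} (hΛ : IsWeight Λ) (ρ : ℝ) {A : GtauS (Rn n) →ₗ[ℂ] GtauS (Rn n)}
    (hA : HasSRegularKernel φ A) :
    ∃ a ∈ SmoothingSymbols Λ ρ, IsPseudoDiffOp φ (fun ε x _ ξ => a ε (x, ξ)) A := by
  obtain ⟨kA, ⟨k, hk, hreg⟩, hA⟩ := hA
  obtain ⟨K, hK, hmod⟩ := hreg.exists_isModerate
  refine ⟨fun ε => symbolOfKernel (K ε), (mem_smoothingSymbols_iff hΛ ρ _).2
    (isModerate_shearFourier _ _ hmod).isSRegularNet, fun u => ?_⟩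
  obtain ⟨v, hv, hAv⟩ := hA k hk u
  refine ⟨v, fun ε x => ?_, hAv⟩
  have h := isOscIntegral_kernelOfSymbol (symbolOfKernel (K ε))
    (integrable_mul_scaledHat φ u.2 ε) x
  rw [kernelOfSymbol_symbolOfKernel, hK] at h
  rw [hv]
  simpa only [mul_assoc] using h

open Colombeau MeasureTheory Bornology in
theorem Colombeau.IsPseudoDiffOp.hasSRegularKernel {n : ℕ} {φ : 𝓢(Rn n, ℂ)}
    {Λ : Rn n × Rn n → ℝ} (hΛ : IsWeight Λ) (ρ : ℝ) {A : GtauS (Rn n) →ₗ[ℂ] GtauS (Rn n)}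
    {a : Eps → Rn n × Rn n → ℂ} (ha : a ∈ SmoothingSymbols Λ ρ)
    (hA : IsPseudoDiffOp φ (fun ε x _ ξ => a ε (x, ξ)) A) : HasSRegularKernel φ A := by
  obtain ⟨U, hU, hmod⟩ := ((mem_smoothingSymbols_iff hΛ ρ a).1 ha).exists_isModerate
  have hreg : IsSRegularNet fun ε => ⇑(kernelOfSymbol (U ε)) :=
    (isModerate_shearFourier _ _ hmod).isSRegularNet
  refine ⟨GtauS.mk ⟨_, hreg.tempered⟩, ⟨_, rfl, hreg⟩, fun k hk u => ?_⟩
  obtain ⟨v, hv, hAv⟩ := hA u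
  have hv' : ∀ ε x, v.1 ε x = ∫ y, kernelOfSymbol (U ε) (x, y) * (u.1 ε y * scaledHat φ ε y) := by
    intro ε x
    have h := isOscIntegral_kernelOfSymbol (U ε) (integrable_mul_scaledHat φ u.2 ε) x
    rw [hU] at h
    exact (hv ε x).unique h
  have hneg : (k.1 - fun ε => ⇑(kernelOfSymbol (U ε))) ∈ Negligible (Rn n × Rn n) :=
    (Submodule.Quotient.eq ((Negligible _).submoduleOf (Tempered _))).1 hk
  have hw := integral_mem_negligible φ hneg u.2
  -- An arbitrary representative `k` of the kernel differs from the one built from the symbol by a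
  -- negligible kernel; its contribution is added to `v` and does not change the class.
  refine ⟨v + ⟨_, negligible_le_tempered _ hw⟩, fun ε x => ?_, ?_⟩
  · obtain ⟨K, hK, -⟩ := exists_schwartz_of_mem_negligible hneg
    have hint : ∀ f : 𝓢(Rn n × Rn n, ℂ),
        Integrable fun y => f (x, y) * (u.1 ε y * scaledHat φ ε y) := fun f =>
      (integrable_mul_scaledHat φ u.2 ε).bdd_mul
        (slice x f).continuous.aestronglyMeasurable
        (Filter.Eventually.of_forall (SchwartzMap.norm_le_seminorm ℝ (slice x f)))
    change v.1 ε x + ∫ y, (k.1 - fun ε => ⇑(kernelOfSymbol (U ε))) ε (x, y) *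
      (u.1 ε y * scaledHat φ ε y) = _
    rw [hv', ← hK, ← integral_add (hint _) (hint _), hK]
    refine integral_congr_ae (Filter.Eventually.of_forall fun y => ?_)
    simp only [Pi.sub_apply]
    ring
  · rw [hAv]
    refine (Submodule.Quotient.eq _).2 ?_
    rw [sub_add_cancel_left]
    exact neg_mem hw

theorem proposition5p5 (n : ℕ) (φ : 𝓢(Colombeau.Rn n, ℂ)) (hφ : Colombeau.IsMollifier φ)
    (Λ : Colombeau.Rn n × Colombeau.Rn n → ℝ) (hΛ : Colombeau.IsWeight Λ)
    (ρ : ℝ) (hρ0 : 0 < ρ) (hρ1 : ρ ≤ 1)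
    (A : Colombeau.GtauS (Colombeau.Rn n) →ₗ[ℂ] Colombeau.GtauS (Colombeau.Rn n)) :
    Colombeau.HasSRegularKernel φ A ↔
      ∃ a ∈ Colombeau.SmoothingSymbols Λ ρ,
        Colombeau.IsPseudoDiffOp φ (fun ε x _ ξ => a ε (x, ξ)) A :=
  ⟨fun hA => hA.exists_isPseudoDiffOp hΛ ρ, fun ⟨_, ha, hA⟩ => hA.hasSRegularKernel hΛ ρ ha⟩
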